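/- For a graph $G$ with $m\ge 1$ edges, vertex degrees $d_v$, and a vertex partition $\mathcal A$, the modularity score is $q_{\mathcal A}(G)=\frac1{2m}\sum_{A\in\mathcal A}\sum_{u,v\in A}\big(\mathbf 1_{uv\in E}-\frac{d_ud_v}{2m}\big)$, the inner sum being over ordered pairs. Let $G_{n,p}$ be the binomial random graph on $[n]=\{1,\dots,n\}$, in which each of the $\binom n2$ possible edges is present independently with probability $p$; an event holds whp if its probability tends to $1$ as $n\to\infty$. The algorithm Swap takes a graph $G$ on $[n]$ and constructs a vertex partition as follows. Let $k=\lfloor n/6\rfloor$, $V_1=\{4k+1,\dots,6k\}$ and $V_2=\{6k+1,\dots,n\}$; for $j=1,2$ let $A_j$ and $B_j$ be the sets of odd and of even elements of $V_j$. For $i=1,\dots,2k$ let $a_i=2i-1$, $b_i=2i$ and $T_i=e(a_i,B_1)-e(a_i,A_1)+e(b_i,A_1)-e(b_i,B_1)$, where $e(v,S)$ is the number of edges between $v$ and $S$. Put $(a_i',b_i')=(b_i,a_i)$ if $T_i>0$ and $(a_i',b_i')=(a_i,b_i)$ otherwise. The output is $\mathcal A=\mathcal A(G)=\{A',B'\}$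 with $A'=\{a_1',\dots,a_{2k}'\}\cup A_1\cup A_2$ and $B'=\{b_1',\dots,b_{2k}'\}\cup B_1\cup B_2$. Theorem. For every graph $G$ on $[n]$ with $n\ge2$, the output of Swap is a partition of $[n]$ into two parts whose sizes differ by at most $1$. Swap runs in linear time: there are a program for a random access machine and a constant $C$ such that, for every $n\ge 1$ and every graph $G$ on $[n]$ with $m$ edges, given by adjacency lists, the program computes $A'$ in at most $C(n+m)$ steps, using only words smaller than $C(n+m)$. Moreover, there are constants $c_0>0$ and $a>0$ such that the following hold. (a) If $p=p(n)\in[0,1]$ satisfies $c_0\le np\le n-c_0$ for $n$ sufficiently large, then whp $q_{\mathcal A}(G_{n,p})\ge\frac15\sqrt{\frac{1-p}{np}}$. (b) If $p=p(n)\in[0,1]$ satisfies $1\le np\le n-c_0$ for $n$ sufficiently large, then whp $q_{\mathcal A}(G_{n,p})\ge a\sqrt{\frac{1-p}{np}}$. Here $\mathcal A=\mathcal A(G_{n,p})$ is the bipartition that Swap constructs from $G_{n,p}$. -/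

import Mathlib

/-! ### Modularity of a vertex partition -/

open scoped Classical in
/-- The modularity score `q_𝒜(G) = (1/2m) ∑_{A ∈ 𝒜} ∑_{u,v ∈ A} (1_{uv ∈ E} - d_u d_v / 2m)`, where
`m` is the number of edges and the inner sum is over ordered pairs. (It is `0` if `m = 0`.) -/
noncomputable def modularityScore {V : Type*} [Fintype V] [DecidableEq V]
    (G : SimpleGraph V)
    (𝒜 : Finpartition (Finset.univ : Finset V)) : ℝ :=
  1 / (2 * (G.edgeSet.ncard : ℝ)) *
    ∑ A ∈ 𝒜.parts, ∑ u ∈ A, ∑ v ∈ A,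
      ((if G.Adj u v then (1 : ℝ) else 0)
        - (G.degree u : ℝ) * (G.degree v : ℝ) / (2 * (G.edgeSet.ncard : ℝ)))

/-! ### The bipartition constructed by Swap

The vertex set is `[n] = {1, …, n}`; the element `v : Fin n` is the vertex with label `v + 1`.
With `k = ⌊n/6⌋`, we have `V₀ = {1, …, 4k}`, `V₁ = {4k+1, …, 6k}` and `V₂ = {6k+1, …, n}`. -/

namespace Swap

/-- The label of `v : Fin n` in `[n] = {1, …, n}`. -/
def label {n : ℕ} (v : Fin n) : ℕ := v.val + 1

/-- The vertices of `V₁` with odd label. -/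
def A₁ (n : ℕ) : Finset (Fin n) :=
  Finset.univ.filter fun v => Odd (label v) ∧ 4 * (n / 6) < label v ∧ label v ≤ 6 * (n / 6)

/-- The vertices of `V₁` with even label. -/
def B₁ (n : ℕ) : Finset (Fin n) :=
  Finset.univ.filter fun v => Even (label v) ∧ 4 * (n / 6) < label v ∧ label v ≤ 6 * (n / 6)

/-- The vertices of `V₂` with odd label. -/
def A₂ (n : ℕ) : Finset (Fin n) :=
  Finset.univ.filter fun v => Odd (label v) ∧ 6 * (n / 6) < label v

/-- The vertices of `V₂` with even label. -/
def B₂ (n : ℕ) : Finset (Fin n) :=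
  Finset.univ.filter fun v => Even (label v) ∧ 6 * (n / 6) < label v

/-- The odd vertex `a_i = 2i - 1` of the `i`-th pair, `1 ≤ i ≤ 2k` (here `i` counts from `0`). -/
def a {n : ℕ} (i : Fin (2 * (n / 6))) : Fin n := ⟨2 * i.val, by omega⟩

/-- The even vertex `b_i = 2i` of the `i`-th pair, `1 ≤ i ≤ 2k` (here `i` counts from `0`). -/
def b {n : ℕ} (i : Fin (2 * (n / 6))) : Fin n := ⟨2 * i.val + 1, by omega⟩

open scoped Classical in
/-- `e(v, S)`, the number of edges between the vertex `v` and the set `S`. -/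
noncomputable def edgesTo {n : ℕ} (G : SimpleGraph (Fin n)) (v : Fin n) (S : Finset (Fin n)) : ℕ :=
  (S.filter fun w => G.Adj v w).card

/-- `T_i = e(a_i, B₁) - e(a_i, A₁) + e(b_i, A₁) - e(b_i, B₁)`. -/
noncomputable def T {n : ℕ} (G : SimpleGraph (Fin n)) (i : Fin (2 * (n / 6))) : ℤ :=
  (edgesTo G (a i) (B₁ n) : ℤ) - (edgesTo G (a i) (A₁ n) : ℤ)
    + (edgesTo G (b i) (A₁ n) : ℤ) - (edgesTo G (b i) (B₁ n) : ℤ)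

/-- `a'_i`: the pair `(a_i, b_i)` is swapped exactly when `T_i > 0`. -/
noncomputable def a' {n : ℕ} (G : SimpleGraph (Fin n)) (i : Fin (2 * (n / 6))) : Fin n :=
  if 0 < T G i then b i else a i

/-- `b'_i`: the pair `(a_i, b_i)` is swapped exactly when `T_i > 0`. -/
noncomputable def b' {n : ℕ} (G : SimpleGraph (Fin n)) (i : Fin (2 * (n / 6))) : Fin n :=
  if 0 < T G i then a i else b i

/-- The part `A' = {a'_1, …, a'_{2k}} ∪ A₁ ∪ A₂`. -/
noncomputable def partA {n : ℕ} (G : SimpleGraph (Fin n)) : Finset (Fin n) :=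
  Finset.univ.image (a' G) ∪ A₁ n ∪ A₂ n

/-- The part `B' = {b'_1, …, b'_{2k}} ∪ B₁ ∪ B₂`. -/
noncomputable def partB {n : ℕ} (G : SimpleGraph (Fin n)) : Finset (Fin n) :=
  Finset.univ.image (b' G) ∪ B₁ n ∪ B₂ n

theorem mem_partA {n : ℕ} (G : SimpleGraph (Fin n)) (v : Fin n) :
    v ∈ partA G ↔ (∃ i, a' G i = v) ∨ (v.val % 2 = 0 ∧ 4 * (n / 6) ≤ v.val) := by
  simp only [partA, A₁, A₂, label, Finset.mem_union, Finset.mem_image, Finset.mem_univ, true_and,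
    Finset.mem_filter, Nat.odd_iff, or_assoc]
  refine or_congr Iff.rfl ?_
  omega

theorem mem_partB {n : ℕ} (G : SimpleGraph (Fin n)) (v : Fin n) :
    v ∈ partB G ↔ (∃ i, b' G i = v) ∨ (v.val % 2 = 1 ∧ 4 * (n / 6) ≤ v.val) := by
  simp only [partB, B₁, B₂, label, Finset.mem_union, Finset.mem_image, Finset.mem_univ, true_and,
    Finset.mem_filter, Nat.even_iff, or_assoc]
  refine or_congr Iff.rfl ?_
  omega

theorem disjoint_parts {n : ℕ} (G : SimpleGraph (Fin n)) : Disjoint (partA G) (partB G) := by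
  rw [Finset.disjoint_left]
  intro v hA hB
  rw [mem_partA] at hA
  rw [mem_partB] at hB
  have key : ∀ i j : Fin (2 * (n / 6)), a' G i ≠ b' G j := by
    intro i j h
    by_cases hij : i = j
    · subst hij
      unfold a' b' at h
      split_ifs at h <;> simp [a, b, Fin.ext_iff] at h
    · have hij' : i.val ≠ j.val := fun h => hij (Fin.ext h)
      unfold a' b' at h
      split_ifs at h <;> simp only [a, b, Fin.ext_iff] at h <;> omega
  have ha : ∀ i, (a' G i).val < 4 * (n / 6) := by
    intro i
    unfold a'
    split_ifs <;> simp only [a, b] <;> omega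
  have hb : ∀ i, (b' G i).val < 4 * (n / 6) := by
    intro i
    unfold b'
    split_ifs <;> simp only [a, b] <;> omega
  rcases hA with ⟨i, rfl⟩ | hA
  · rcases hB with ⟨j, hj⟩ | hB
    · exact key i j hj.symm
    · have := ha i
      omega
  · rcases hB with ⟨j, rfl⟩ | hB
    · have := hb j
      omega
    · omega

theorem union_parts {n : ℕ} (G : SimpleGraph (Fin n)) : partA G ∪ partB G = Finset.univ := by
  ext v
  simp only [Finset.mem_union, Finset.mem_univ, iff_true, mem_partA, mem_partB]
  by_cases hv : v.val < 4 * (n / 6)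
  · have hi : v.val / 2 < 2 * (n / 6) := by omega
    rcases Nat.mod_two_eq_zero_or_one v.val with h | h
    · have hva : a ⟨v.val / 2, hi⟩ = v := by
        apply Fin.ext
        simp only [a]
        omega
      by_cases hT : 0 < T G ⟨v.val / 2, hi⟩
      · exact Or.inr (Or.inl ⟨_, by rw [b', if_pos hT, hva]⟩)
      · exact Or.inl (Or.inl ⟨_, by rw [a', if_neg hT, hva]⟩)
    · have hvb : b ⟨v.val / 2, hi⟩ = v := by
        apply Fin.ext
        simp only [b]
        omega
      by_cases hT : 0 < T G ⟨v.val / 2, hi⟩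
      · exact Or.inl (Or.inl ⟨_, by rw [a', if_pos hT, hvb]⟩)
      · exact Or.inr (Or.inl ⟨_, by rw [b', if_neg hT, hvb]⟩)
  · omega

/-- The vertex partition `{A', B'}` constructed by Swap from the graph `G`. (An empty part, which
occurs only for `n ≤ 1`, is left out.) -/
noncomputable def partition {n : ℕ} (G : SimpleGraph (Fin n)) :
    Finpartition (Finset.univ : Finset (Fin n)) :=
  Finpartition.ofErase {partA G, partB G}
    (by
      by_cases h : partA G = partB G
      · rw [h, Finset.pair_eq_singleton]
        exact Finset.supIndep_singleton _ _
      · rw [Finset.supIndep_pair h]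
        exact disjoint_parts G)
    (by simpa using union_parts G)

end Swap

/-! ### A random access machine with step count and bounded words -/

namespace RAM

/-- Structured programs for a random access machine with registers (named by natural numbers), a
work memory of addressable cells and a random access read-only input. -/
inductive Cmd : Type
  /-- do nothing -/
  | skip : Cmd
  /-- `r_x := c` -/
  | const (x c : ℕ) : Cmd
  /-- `r_x := r_y + r_z` -/
  | add (x y z : ℕ) : Cmd
  /-- `r_x := r_y - r_z` (truncated at `0`) -/
  | sub (x y z : ℕ) : Cmd
  /-- `r_x := input[r_y]` -/
  | read (x y : ℕ) : Cmd
  /-- `r_x := mem[r_y]` -/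
  | load (x y : ℕ) : Cmd
  /-- `mem[r_x] := r_y` -/
  | store (x y : ℕ) : Cmd
  /-- first `c`, then `d` -/
  | seq (c d : Cmd) : Cmd
  /-- `if r_x < r_y then c else d` -/
  | ifLt (x y : ℕ) (c d : Cmd) : Cmd
  /-- `while r_x < r_y do c` -/
  | whileLt (x y : ℕ) (c : Cmd) : Cmd

/-- The contents of the registers and of the work memory. -/
structure State where
  reg : ℕ → ℕ
  mem : ℕ → ℕ

/-- All registers and all cells of the work memory hold `0`. -/
def State.init : State := ⟨fun _ => 0, fun _ => 0⟩

/-- Write `v` into register `x`. -/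
def State.setReg (s : State) (x v : ℕ) : State := ⟨Function.update s.reg x v, s.mem⟩

/-- Write `v` into the memory cell with address `i`. -/
def State.setMem (s : State) (i v : ℕ) : State := ⟨s.reg, Function.update s.mem i v⟩

/-- `Exec W inp c s t s'`: on the input `inp`, the program `c` started in state `s` halts in state
`s'` after exactly `t` steps, and every word written on the way is smaller than `W`. Every
elementary instruction and every evaluation of a test is one step. -/
inductive Exec (W : ℕ) (inp : ℕ → ℕ) : Cmd → State → ℕ → State → Prop
  | skip (s : State) : Exec W inp .skip s 1 s
  | const (s : State) (x c : ℕ) (h : c < W) :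
      Exec W inp (.const x c) s 1 (s.setReg x c)
  | add (s : State) (x y z : ℕ) (h : s.reg y + s.reg z < W) :
      Exec W inp (.add x y z) s 1 (s.setReg x (s.reg y + s.reg z))
  | sub (s : State) (x y z : ℕ) (h : s.reg y - s.reg z < W) :
      Exec W inp (.sub x y z) s 1 (s.setReg x (s.reg y - s.reg z))
  | read (s : State) (x y : ℕ) (h : inp (s.reg y) < W) :
      Exec W inp (.read x y) s 1 (s.setReg x (inp (s.reg y)))
  | load (s : State) (x y : ℕ) (h : s.mem (s.reg y) < W) :
      Exec W inp (.load x y) s 1 (s.setReg x (s.mem (s.reg y)))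
  | store (s : State) (x y : ℕ) (h : s.reg y < W) :
      Exec W inp (.store x y) s 1 (s.setMem (s.reg x) (s.reg y))
  | seq (s s' s'' : State) (c d : Cmd) (t t' : ℕ)
      (hc : Exec W inp c s t s') (hd : Exec W inp d s' t' s'') :
      Exec W inp (.seq c d) s (t + t') s''
  | ifTrue (s s' : State) (x y : ℕ) (c d : Cmd) (t : ℕ) (h : s.reg x < s.reg y)
      (hc : Exec W inp c s t s') :
      Exec W inp (.ifLt x y c d) s (1 + t) s'
  | ifFalse (s s' : State) (x y : ℕ) (c d : Cmd) (t : ℕ) (h : ¬ s.reg x < s.reg y)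
      (hd : Exec W inp d s t s') :
      Exec W inp (.ifLt x y c d) s (1 + t) s'
  | whileTrue (s s' s'' : State) (x y : ℕ) (c : Cmd) (t t' : ℕ) (h : s.reg x < s.reg y)
      (hc : Exec W inp c s t s') (hw : Exec W inp (.whileLt x y c) s' t' s'') :
      Exec W inp (.whileLt x y c) s (1 + t + t') s''
  | whileFalse (s : State) (x y : ℕ) (c : Cmd) (h : ¬ s.reg x < s.reg y) :
      Exec W inp (.whileLt x y c) s 1 s

/-- `L` is an adjacency list representation of `G`: for each vertex `v`, the list `L v` contains
each neighbour of `v` exactly once (in any order) and nothing else. -/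
def IsAdjList {n : ℕ} (G : SimpleGraph (Fin n)) (L : Fin n → List (Fin n)) : Prop :=
  ∀ v, (L v).Nodup ∧ ∀ w, w ∈ L v ↔ G.Adj v w

/-- The input that presents a graph by adjacency lists: the number `n`, followed for each vertex
`v = 0, …, n - 1` by the length of its list and the entries of its list. These are
`1 + n + 2m` words, where `m` is the number of edges. -/
def encode {n : ℕ} (L : Fin n → List (Fin n)) : List ℕ :=
  n :: (List.finRange n).flatMap fun v => (L v).length :: (L v).map Fin.val

/-- The input as a random access array (cells beyond its length hold `0`). -/
def input {n : ℕ} (L : Fin n → List (Fin n)) : ℕ → ℕ := fun i => (encode L).getD i 0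

/-- The program `P` computes the set of vertices `S G` from every adjacency list representation of
every graph `G`, in time `O(n + m)` with words of `log₂ (n + m) + O(1)` bits: it halts with
`mem[v] = 1` for the vertices `v` in `S G` and `mem[v] = 0` for the other vertices. -/
def ComputesInLinearTime (P : Cmd)
    (S : {n : ℕ} → SimpleGraph (Fin n) → Finset (Fin n)) : Prop :=
  ∃ C : ℕ, ∀ n : ℕ, 1 ≤ n → ∀ (G : SimpleGraph (Fin n)) (L : Fin n → List (Fin n)),
    IsAdjList G L →
      ∃ (t : ℕ) (s : State),
        Exec (C * (n + G.edgeSet.ncard)) (input L) P State.init t s ∧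
        t ≤ C * (n + G.edgeSet.ncard) ∧
        ∀ v : Fin n, s.mem v.val = if v ∈ S G then 1 else 0

end RAM

/-!
Write the bipartition as a sign `s_v = ±1` on the vertices. With `2m = ∑ d_v`, its modularity is
`(1/4m) (∑_{u,v} s_u s_v 1_{uv ∈ E} - (∑ s_v d_v)² / 2m)`. Swap chooses the signs of the pairs so
that the edges between `V₀` and `V₁` contribute exactly `∑ |T_i|` to `∑_{uv ∈ E} s_u s_v`, and the
`T_i` are independent because they look at disjoint sets of edges. Since `T_i` is a signed sum of
`2k` differences of two independent edge indicators, `E cos(t T_i) = (1 - 2p(1-p)(1 - cos t))^{2k}`.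
Bounding `|x|` below by a partial Fourier sum of a triangle wave gives `E |T_i| ≥ (3/4) σ` when
`σ² = 4kp(1-p)` is large, and a single cosine gives `E |T_i| ≥ 0.18 σ` in general.

The fluctuations of everything else have second moment `O(n² p(1-p))` by orthogonality, against a
gain of order `n √(np(1-p))`, so Chebyshev's inequality applies. For the degree imbalance
`∑ s_v d_v` the contribution of the `V₀`-`V₁` edges is centred because relabelling the vertices by
exchanging `2i - 1` with `2i` for all `i` preserves every `T_i` but negates this contribution.

The program scans each adjacency list at most once, so the position of its reading head in the
input serves as the potential in the running time analysis.
-/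

/-! ### Modularity of a bipartition in terms of signs -/

section Modularity

variable {V : Type*}

/-- The variable `1_{e ∈ E(G)}`, for an unordered pair `e` of vertices. -/
noncomputable def edgeIndicator (G : SimpleGraph V) (e : Sym2 V) : ℝ := G.edgeSet.indicator 1 e

theorem edgeIndicator_eq_zero_or_one (G : SimpleGraph V) (e : Sym2 V) :
    edgeIndicator G e = 0 ∨ edgeIndicator G e = 1 :=
  Set.indicator_eq_zero_or_self _ _ _

theorem edgeIndicator_self (G : SimpleGraph V) (v : V) : edgeIndicator G s(v, v) = 0 := by
  simp [edgeIndicator]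

open scoped Classical in
theorem edgeIndicator_mk (G : SimpleGraph V) (u v : V) :
    edgeIndicator G s(u, v) = if G.Adj u v then 1 else 0 := by
  simp [edgeIndicator, Set.indicator_apply]

open scoped Classical in
/-- The sign vector of the bipartition `{A, Aᶜ}`. -/
noncomputable def partSign (A : Finset V) (v : V) : ℝ := if v ∈ A then 1 else -1

theorem partSign_eq_one_or_neg_one (A : Finset V) (v : V) :
    partSign A v = 1 ∨ partSign A v = -1 := by
  unfold partSign
  split_ifs <;> simp

variable [Fintype V]

theorem degree_eq_sum_edgeIndicator (G : SimpleGraph V) [DecidableRel G.Adj] (u : V) :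
    (G.degree u : ℝ) = ∑ v, edgeIndicator G s(u, v) := by
  classical
  rw [← SimpleGraph.card_neighborFinset_eq_degree, SimpleGraph.neighborFinset_eq_filter]
  rw [Finset.natCast_card_filter]
  exact Finset.sum_congr rfl fun v _ => by rw [edgeIndicator_mk]; congr

theorem two_mul_ncard_edgeSet (G : SimpleGraph V) :
    2 * (G.edgeSet.ncard : ℝ) = ∑ u, ∑ v, edgeIndicator G s(u, v) := by
  classical
  rw [← SimpleGraph.coe_edgeFinset, Set.ncard_coe_finset, ← Nat.cast_two, ← Nat.cast_mul,
    ← G.sum_degrees_eq_twice_card_edges, Nat.cast_sum]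
  exact Finset.sum_congr rfl fun u _ => degree_eq_sum_edgeIndicator G u

theorem sum_eq_sum_one_add_partSign (A : Finset V) (f : V → ℝ) :
    ∑ v ∈ A, f v = ∑ v, (1 + partSign A v) / 2 * f v := by
  classical
  rw [Finset.sum_subset_zero_on_sdiff (Finset.subset_univ A)]
  · intro v hv
    rw [partSign, if_neg (by simpa using hv)]
    ring
  · intro v hv
    rw [partSign, if_pos hv]
    ring

variable [DecidableEq V]

theorem sum_compl_eq_sum_one_sub_partSign (A : Finset V) (f : V → ℝ) :
    ∑ v ∈ Aᶜ, f v = ∑ v, (1 - partSign A v) / 2 * f v := by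
  rw [eq_sub_of_add_eq' (Finset.sum_add_sum_compl A f), sum_eq_sum_one_add_partSign A,
    ← Finset.sum_sub_distrib]
  exact Finset.sum_congr rfl fun v _ => by ring

theorem sum_partSign (A : Finset V) : ∑ v, partSign A v = A.card - Aᶜ.card := by
  have hA := sum_eq_sum_one_add_partSign A 1
  have hAc := sum_compl_eq_sum_one_sub_partSign A 1
  simp only [Pi.one_apply, mul_one, Finset.sum_const, nsmul_eq_mul] at hA hAc
  rw [hA, hAc, ← Finset.sum_sub_distrib]
  exact Finset.sum_congr rfl fun v _ => by ring

theorem sum_sum_add_sum_sum_compl (A : Finset V) (f : V → V → ℝ) :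
    (∑ u ∈ A, ∑ v ∈ A, f u v) + ∑ u ∈ Aᶜ, ∑ v ∈ Aᶜ, f u v
      = (∑ u, ∑ v, f u v + ∑ u, ∑ v, partSign A u * partSign A v * f u v) / 2 := by
  simp only [sum_eq_sum_one_add_partSign A, sum_compl_eq_sum_one_sub_partSign A,
    Finset.mul_sum, ← Finset.sum_add_distrib, Finset.sum_div]
  exact Finset.sum_congr rfl fun u _ => Finset.sum_congr rfl fun v _ => by ring

/-- Writing `d` for the degrees, `s` for the signs and `M = 2m`, the sum of
`1_{uv ∈ E} - d_u d_v / M` over all `u, v` vanishes, and that of `s_u s_v d_u d_v` is a square. -/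
theorem modularityScore_eq_of_parts_eq_pair [Nonempty V] (G : SimpleGraph V)
    {𝒜 : Finpartition (Finset.univ : Finset V)} {A : Finset V} (h𝒜 : 𝒜.parts = {A, Aᶜ}) {M : ℝ}
    (hM : ∑ u, ∑ v, edgeIndicator G s(u, v) = M) :
    modularityScore G 𝒜 = 1 / (2 * M) *
      (∑ u, ∑ v, partSign A u * partSign A v * edgeIndicator G s(u, v)
        - (∑ u, ∑ v, partSign A u * edgeIndicator G s(u, v)) ^ 2 / M) := by
  classical
  set d : V → ℝ := fun u => ∑ v, edgeIndicator G s(u, v) with hd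
  have score : modularityScore G 𝒜 = 1 / M * ∑ X ∈ {A, Aᶜ}, ∑ u ∈ X, ∑ v ∈ X,
      (edgeIndicator G s(u, v) - d u * d v / M) := by
    simp only [modularityScore, h𝒜, two_mul_ncard_edgeSet, hM, ← edgeIndicator_mk,
      degree_eq_sum_edgeIndicator, d]
  have unsigned : ∑ u, ∑ v, (edgeIndicator G s(u, v) - d u * d v / M) = 0 := by
    simp only [Finset.sum_sub_distrib, ← Finset.sum_div, ← Finset.sum_mul_sum]
    rw [hM, mul_self_div_self, sub_self]
  have signed : ∑ u, ∑ v, partSign A u * partSign A v * (edgeIndicator G s(u, v) - d u * d v / M)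
      = ∑ u, ∑ v, partSign A u * partSign A v * edgeIndicator G s(u, v)
        - (∑ u, ∑ v, partSign A u * edgeIndicator G s(u, v)) ^ 2 / M := by
    simp only [mul_sub, Finset.sum_sub_distrib, ← Finset.mul_sum]
    congr 1
    rw [sq, Finset.sum_mul_sum, Finset.sum_div]
    exact Finset.sum_congr rfl fun u _ => by
      rw [Finset.sum_div]
      exact Finset.sum_congr rfl fun v _ => by rw [hd]; ring
  rw [score, Finset.sum_pair ne_compl_self, sum_sum_add_sum_sum_compl, unsigned, signed,
    zero_add]
  ring

end Modularity

namespace Swap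

variable {n : ℕ}

/-! ### The signs of the two parts of Swap -/

/-- The sign `+1` on the part `A'` and `-1` on the part `B'`. -/
noncomputable def spin (G : SimpleGraph (Fin n)) (v : Fin n) : ℝ := partSign (partA G) v

/-- The sign `+1` on odd labels and `-1` on even labels. -/
def parity (v : Fin n) : ℝ := if v.val % 2 = 0 then 1 else -1

theorem spin_eq_one_or_neg_one (G : SimpleGraph (Fin n)) (v : Fin n) :
    spin G v = 1 ∨ spin G v = -1 :=
  partSign_eq_one_or_neg_one _ _

theorem parity_eq_one_or_neg_one (v : Fin n) : parity v = 1 ∨ parity v = -1 := by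
  unfold parity
  split_ifs <;> simp

theorem a'_val_lt (G : SimpleGraph (Fin n)) (i : Fin (2 * (n / 6))) :
    (a' G i).val < 4 * (n / 6) := by
  unfold a'
  split_ifs <;> simp only [a, b] <;> omega

theorem a_mem_partA (G : SimpleGraph (Fin n)) (i : Fin (2 * (n / 6))) :
    a i ∈ partA G ↔ ¬ 0 < T G i := by
  rw [mem_partA]
  refine ⟨?_, fun h => Or.inl ⟨i, if_neg h⟩⟩
  rintro (⟨j, hj⟩ | h) hT
  · unfold a' at hj
    split_ifs at hj with hTj <;> simp only [a, b, Fin.ext_iff] at hj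
    · omega
    · rw [show j = i from Fin.ext (by omega)] at hTj
      exact hTj hT
  · simp only [a] at h
    omega

theorem b_mem_partA (G : SimpleGraph (Fin n)) (i : Fin (2 * (n / 6))) :
    b i ∈ partA G ↔ 0 < T G i := by
  rw [mem_partA]
  refine ⟨?_, fun h => Or.inl ⟨i, if_pos h⟩⟩
  rintro (⟨j, hj⟩ | h)
  · unfold a' at hj
    split_ifs at hj with hTj <;> simp only [a, b, Fin.ext_iff] at hj
    · rwa [show j = i from Fin.ext (by omega)] at hTj
    · omega
  · simp only [b] at h
    omega

theorem mem_partA_of_le (G : SimpleGraph (Fin n)) {v : Fin n} (hv : 4 * (n / 6) ≤ v.val) :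
    v ∈ partA G ↔ v.val % 2 = 0 := by
  rw [mem_partA]
  refine ⟨?_, fun h => Or.inr ⟨h, hv⟩⟩
  rintro (⟨j, rfl⟩ | h)
  · exact absurd (a'_val_lt G j) (by omega)
  · exact h.1

theorem spin_a (G : SimpleGraph (Fin n)) (i : Fin (2 * (n / 6))) :
    spin G (a i) = if 0 < T G i then -1 else 1 := by
  simp only [spin, partSign, a_mem_partA, ite_not]

theorem spin_b (G : SimpleGraph (Fin n)) (i : Fin (2 * (n / 6))) :
    spin G (b i) = if 0 < T G i then 1 else -1 := by
  simp only [spin, partSign, b_mem_partA]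

theorem spin_a_eq_neg (G : SimpleGraph (Fin n)) (i : Fin (2 * (n / 6))) :
    spin G (a i) = -spin G (b i) := by
  rw [spin_a, spin_b]
  split_ifs <;> norm_num

theorem spin_of_le (G : SimpleGraph (Fin n)) {v : Fin n} (hv : 4 * (n / 6) ≤ v.val) :
    spin G v = parity v := by
  simp only [spin, partSign, parity, mem_partA_of_le G hv]

/-- The other vertex of the pair `{2i - 1, 2i}`; the vertex `n` is its own partner if `n` is odd. -/
def partner (v : Fin n) : Fin n :=
  if v.val % 2 = 0 then
    if h : v.val + 1 < n then ⟨v.val + 1, h⟩ else v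
  else ⟨v.val - 1, by omega⟩

theorem partner_val (v : Fin n) (hv : v.val + 1 < n ∨ n % 2 = 0) :
    (partner v).val = if v.val % 2 = 0 then v.val + 1 else v.val - 1 := by
  have := v.isLt
  unfold partner
  split_ifs <;> first | rfl | omega

theorem partner_involutive : Function.Involutive (partner (n := n)) := by
  intro v
  have := v.isLt
  apply Fin.ext
  unfold partner
  split_ifs <;> simp_all <;> omega

theorem exists_eq_a_or_eq_b {v : Fin n} (hv : v.val < 4 * (n / 6)) : ∃ i, v = a i ∨ v = b i := by
  refine ⟨⟨v.val / 2, by omega⟩, ?_⟩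
  simp only [a, b, Fin.ext_iff]
  omega

theorem partner_a (i : Fin (2 * (n / 6))) : partner (a i) = b i := by
  apply Fin.ext
  rw [partner_val _ (Or.inl (by simp only [a]; omega))]
  simp [a, b]

theorem partner_b (i : Fin (2 * (n / 6))) : partner (b i) = a i := by
  rw [← partner_a, partner_involutive]

theorem parity_partner {v : Fin n} (hv : v.val + 1 < n ∨ n % 2 = 0) :
    parity (partner v) = -parity v := by
  unfold parity
  rw [partner_val v hv]
  split_ifs <;> first | omega | norm_num

theorem spin_partner (G : SimpleGraph (Fin n)) {v : Fin n} (hv : v.val + 1 < n ∨ n % 2 = 0) :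
    spin G (partner v) = -spin G v := by
  by_cases h : v.val < 4 * (n / 6)
  · obtain ⟨i, rfl | rfl⟩ := exists_eq_a_or_eq_b h
    · rw [partner_a, spin_a_eq_neg, neg_neg]
    · rw [partner_b, spin_a_eq_neg]
  · have : 4 * (n / 6) ≤ (partner v).val := by
      rw [partner_val v hv]
      split_ifs <;> omega
    rw [spin_of_le G this, spin_of_le G (by omega), parity_partner hv]

theorem partner_ne {v : Fin n} (hv : v.val + 1 < n ∨ n % 2 = 0) : partner v ≠ v := by
  intro h
  have := congrArg Fin.val h
  rw [partner_val v hv] at this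
  split_ifs at this <;> omega

theorem sum_eq_zero_of_partner {S : Finset (Fin n)} {f : Fin n → ℝ}
    (hS : ∀ v ∈ S, partner v ∈ S) (hS' : ∀ v ∈ S, v.val + 1 < n ∨ n % 2 = 0)
    (hf : ∀ v ∈ S, f (partner v) = -f v) : ∑ v ∈ S, f v = 0 :=
  Finset.sum_involution (fun v _ => partner v) (fun v hv => by rw [hf v hv, add_neg_cancel])
    (fun v hv _ => partner_ne (hS' v hv)) hS (fun v _ => partner_involutive v)

theorem sum_spin (G : SimpleGraph (Fin n)) : ∑ v, spin G v = (n % 2 : ℕ) := by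
  rcases Nat.mod_two_eq_zero_or_one n with h | h
  · rw [h, Nat.cast_zero]
    exact sum_eq_zero_of_partner (fun _ _ => Finset.mem_univ _) (fun _ _ => Or.inr h)
      (fun v _ => spin_partner G (Or.inr h))
  let last : Fin n := ⟨n - 1, by omega⟩
  have paired : ∀ v ∈ Finset.univ.erase last, v.val + 1 < n := by
    intro v hv
    have : v.val ≠ n - 1 := by simpa [last, Fin.ext_iff] using hv
    omega
  have sum_paired : ∑ v ∈ Finset.univ.erase last, spin G v = 0 := by
    refine sum_eq_zero_of_partner (fun v hv => ?_) (fun v hv => Or.inl (paired v hv))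
      (fun v hv => spin_partner G (Or.inl (paired v hv)))
    have hv' := paired v hv
    simp only [Finset.mem_erase, Finset.mem_univ, and_true, ne_eq, Fin.ext_iff, last]
    rw [partner_val v (Or.inl hv')]
    split_ifs <;> omega
  have spin_last : spin G last = 1 := by
    rw [spin_of_le G (by dsimp only [last]; omega), parity, if_pos (by dsimp only [last]; omega)]
  rw [← Finset.add_sum_erase _ _ (Finset.mem_univ last), sum_paired, spin_last, h]
  simp

theorem partB_eq_compl (G : SimpleGraph (Fin n)) : partB G = (partA G)ᶜ :=
  (IsCompl.of_eq (Finset.disjoint_iff_inter_eq_empty.1 (disjoint_parts G))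
    (union_parts G)).compl_eq.symm

theorem card_partA_add_card_partB (G : SimpleGraph (Fin n)) :
    (partA G).card + (partB G).card = n := by
  rw [partB_eq_compl, Finset.card_add_card_compl, Fintype.card_fin]

theorem card_partA_eq (G : SimpleGraph (Fin n)) : (partA G).card = (partB G).card + n % 2 := by
  have h : ∑ v, partSign (partA G) v = (n % 2 : ℕ) := sum_spin G
  rw [sum_partSign, ← partB_eq_compl, sub_eq_iff_eq_add'] at h
  exact_mod_cast h

theorem partition_parts (hn : 2 ≤ n) (G : SimpleGraph (Fin n)) :
    (partition G).parts = {partA G, partB G} := by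
  have h₁ := card_partA_add_card_partB G
  have h₂ := card_partA_eq G
  refine Finset.erase_eq_of_notMem ?_
  simp only [Finset.bot_eq_empty, Finset.mem_insert, Finset.mem_singleton, not_or]
  constructor <;> intro h <;> simp only [← h, Finset.card_empty] at h₁ h₂ <;> omega

theorem card_parts_partition (hn : 2 ≤ n) (G : SimpleGraph (Fin n)) :
    (partition G).parts.card = 2 := by
  have : Nonempty (Fin n) := ⟨⟨0, by omega⟩⟩
  rw [partition_parts hn, partB_eq_compl, Finset.card_pair ne_compl_self]

theorem isEquipartition_partition (hn : 2 ≤ n) (G : SimpleGraph (Fin n)) :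
    (partition G).IsEquipartition := by
  have h := card_partA_eq G
  intro X Y hX hY
  rw [partition_parts hn] at hX hY
  simp only [Finset.coe_insert, Finset.coe_singleton, Set.mem_insert_iff,
    Set.mem_singleton_iff] at hX hY
  rcases hX with rfl | rfl <;> rcases hY with rfl | rfl <;> omega

theorem modularityScore_partition (hn : 2 ≤ n) (G : SimpleGraph (Fin n)) {M : ℝ}
    (hM : ∑ u, ∑ v, edgeIndicator G s(u, v) = M) :
    modularityScore G (partition G) = 1 / (2 * M) *
      (∑ u, ∑ v, spin G u * spin G v * edgeIndicator G s(u, v)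
        - (∑ u, ∑ v, spin G u * edgeIndicator G s(u, v)) ^ 2 / M) := by
  have : Nonempty (Fin n) := ⟨⟨0, by omega⟩⟩
  exact modularityScore_eq_of_parts_eq_pair G (partB_eq_compl G ▸ partition_parts hn G) hM

end Swap

/-! ### Edge-independence in the binomial random graph -/

section EdgeIndependence

open MeasureTheory ProbabilityTheory SimpleGraph unitInterval
open scoped ENNReal

theorem integral_sq_sum_of_orthogonal {Ω ι : Type*} {mΩ : MeasurableSpace Ω} {μ : Measure Ω}
    {K : Finset ι} {f : ι → Ω → ℝ} (hf : ∀ x ∈ K, MemLp (f x) 2 μ)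
    (horth : ∀ x ∈ K, ∀ y ∈ K, x ≠ y → ∫ ω, f x ω * f y ω ∂μ = 0) :
    ∫ ω, (∑ x ∈ K, f x ω) ^ 2 ∂μ = ∑ x ∈ K, ∫ ω, f x ω ^ 2 ∂μ := by
  have hint : ∀ x ∈ K, ∀ y ∈ K, Integrable (fun ω => f x ω * f y ω) μ :=
    fun x hx y hy => (hf x hx).integrable_mul (hf y hy)
  simp only [sq, Finset.sum_mul_sum]
  rw [integral_finsetSum _ fun x hx => integrable_finsetSum _ (hint x hx)]
  refine Finset.sum_congr rfl fun x hx => ?_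
  rw [integral_finsetSum _ (hint x hx), Finset.sum_eq_single_of_mem x hx]
  exact fun y hy hyx => horth x hx y hy hyx.symm

variable {V : Type*} {β γ : Type*}

/-- `f G` is determined by the edges of `G` in `S`. -/
def DependsOnEdges (f : SimpleGraph V → β) (S : Set (Sym2 V)) : Prop :=
  ∀ ⦃G H : SimpleGraph V⦄, (∀ e ∈ S, e ∈ G.edgeSet ↔ e ∈ H.edgeSet) → f G = f H

namespace DependsOnEdges

variable {f : SimpleGraph V → β} {S S' : Set (Sym2 V)}

theorem mono (hf : DependsOnEdges f S) (h : S ⊆ S') : DependsOnEdges f S' :=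
  fun _ _ hGH => hf fun e he => hGH e (h he)

theorem comp (hf : DependsOnEdges f S) (φ : β → γ) : DependsOnEdges (fun G => φ (f G)) S :=
  fun _ _ hGH => congrArg φ (hf hGH)

theorem comp₂ {δ : Type*} {g : SimpleGraph V → γ} (hf : DependsOnEdges f S)
    (hg : DependsOnEdges g S) (φ : β → γ → δ) : DependsOnEdges (fun G => φ (f G) (g G)) S :=
  fun _ _ hGH => congrArg₂ φ (hf hGH) (hg hGH)

theorem sum {ι : Type*} {K : Finset ι} {f : ι → SimpleGraph V → ℝ}
    (hf : ∀ x ∈ K, DependsOnEdges (f x) S) : DependsOnEdges (fun G => ∑ x ∈ K, f x G) S :=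
  fun _ _ hGH => Finset.sum_congr rfl fun x hx => hf x hx hGH

theorem edgeIndicator {e : Sym2 V} (he : e ∈ S) :
    DependsOnEdges (fun G => edgeIndicator G e) S :=
  fun _ _ hGH => by classical simp only [_root_.edgeIndicator, Set.indicator_apply, hGH e he]

end DependsOnEdges

variable {p : I}

section Countable

variable [Countable V]

theorem map_edgeSet_binomialRandom :
    G(V, p).map edgeSet = setBernoulli Sym2.diagSetᶜ p := by
  rw [binomialRandom, measurableEmbedding_edgeSet.map_comap, Measure.restrict_eq_self_of_ae_mem]
  filter_upwards [setBernoulli_ae_subset] with S hS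
  exact ⟨fromEdgeSet S, by simpa [← Set.disjoint_compl_right_iff_subset] using hS⟩

omit [Countable V] in
theorem measurable_mem_edgeSet : Measurable fun (G : SimpleGraph V) e => e ∈ G.edgeSet :=
  MeasurableEquiv.setOfPred.symm.measurable.comp measurable_edgeSet

theorem map_mem_edgeSet_binomialRandom :
    G(V, p).map (fun G e => e ∈ G.edgeSet) = Measure.infinitePi fun e : Sym2 V =>
      toNNReal p • Measure.dirac (e ∈ Sym2.diagSetᶜ) + toNNReal (σ p) • Measure.dirac False := by
  have h : (fun (G : SimpleGraph V) e => e ∈ G.edgeSet)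
      = MeasurableEquiv.setOfPred.symm ∘ edgeSet := rfl
  rw [h, ← Measure.map_map (MeasurableEquiv.measurable _) measurable_edgeSet,
    map_edgeSet_binomialRandom, setBernoulli_eq_map]
  exact MeasurableEquiv.map_symm_map MeasurableEquiv.setOfPred

theorem map_mem_edgeSet_apply_binomialRandom (e : Sym2 V) :
    G(V, p).map (fun G => e ∈ G.edgeSet) =
      toNNReal p • Measure.dirac (e ∈ Sym2.diagSetᶜ) + toNNReal (σ p) • Measure.dirac False := by
  have h := congrArg (Measure.map (Function.eval e))
    (map_mem_edgeSet_binomialRandom (V := V) (p := p))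
  rwa [Measure.infinitePi_map_eval, Measure.map_map (measurable_pi_apply e) measurable_mem_edgeSet]
    at h

theorem iIndepFun_mem_edgeSet : iIndepFun (fun (e : Sym2 V) G => e ∈ G.edgeSet) G(V, p) := by
  rw [iIndepFun_iff_map_fun_eq_infinitePi_map (measurable_pi_iff.1 measurable_mem_edgeSet),
    map_mem_edgeSet_binomialRandom]
  simp only [map_mem_edgeSet_apply_binomialRandom]

end Countable

section Finite

variable [Finite V]

instance : DiscreteMeasurableSpace (SimpleGraph V) :=
  haveI : MeasurableSingletonClass (SimpleGraph V) := ⟨fun G => by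
    rw [← edgeSet_injective.preimage_image {G}, Set.image_singleton]
    exact measurable_edgeSet (measurableSet_singleton G.edgeSet)⟩
  inferInstance

theorem integral_edgeIndicator {e : Sym2 V} (he : ¬ e.IsDiag) :
    ∫ G, edgeIndicator G e ∂G(V, p) = p := by
  calc ∫ G, edgeIndicator G e ∂G(V, p)
      = G(V, p).real ((fun G => e ∈ G.edgeSet) ⁻¹' {True}) := by
        rw [← integral_indicator_one .of_discrete]
        congr! 2 with G
        classical simp [edgeIndicator, Set.indicator_apply]
    _ = (G(V, p).map fun G => e ∈ G.edgeSet).real {True} :=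
        (map_measureReal_apply .of_discrete .of_discrete).symm
    _ = p := by
        rw [map_mem_edgeSet_apply_binomialRandom]
        simp [measureReal_def, he]

theorem DependsOnEdges.factorsThrough {f : SimpleGraph V → β} {S : Set (Sym2 V)}
    (hf : DependsOnEdges f S) :
    f.FactorsThrough fun G (e : S.toFinite.toFinset) => e.1 ∈ G.edgeSet := fun _ _ hGH =>
  hf fun e he => iff_of_eq (congrFun hGH ⟨e, by simpa using he⟩)

theorem DependsOnEdges.indepFun [MeasurableSpace β] [MeasurableSpace γ] {f : SimpleGraph V → β}
    {g : SimpleGraph V → γ} {S T : Set (Sym2 V)} (hf : DependsOnEdges f S)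
    (hg : DependsOnEdges g T) (hST : Disjoint S T) : IndepFun f g G(V, p) := by
  have hindep := iIndepFun_mem_edgeSet (p := p).indepFun_finset S.toFinite.toFinset
    T.toFinite.toFinset (by simpa using hST) fun _ => .of_discrete
  rw [← hf.factorsThrough.extend_comp fun _ => f ⊥, ← hg.factorsThrough.extend_comp fun _ => g ⊥]
  exact hindep.comp .of_discrete .of_discrete

theorem DependsOnEdges.integral_mul {f g : SimpleGraph V → ℝ} {S T : Set (Sym2 V)}
    (hf : DependsOnEdges f S) (hg : DependsOnEdges g T) (hST : Disjoint S T) :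
    ∫ G, f G * g G ∂G(V, p) = (∫ G, f G ∂G(V, p)) * ∫ G, g G ∂G(V, p) :=
  (hf.indepFun hg hST).integral_fun_mul_eq_mul_integral .of_discrete .of_discrete

theorem integral_edgeIndicator_sub {e : Sym2 V} (he : ¬ e.IsDiag) :
    ∫ G, (edgeIndicator G e - p) ∂G(V, p) = 0 := by
  rw [integral_sub .of_finite .of_finite, integral_edgeIndicator he, integral_const]
  simp

theorem integral_edgeIndicator_sub_sq {e : Sym2 V} (he : ¬ e.IsDiag) :
    ∫ G, (edgeIndicator G e - p) ^ 2 ∂G(V, p) = p * (1 - p) := by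
  have h : ∀ G : SimpleGraph V, (edgeIndicator G e - p) ^ 2
      = (1 - 2 * p) * (edgeIndicator G e - p) + p * (1 - p) := fun G => by
    rcases edgeIndicator_eq_zero_or_one G e with h | h <;> rw [h] <;> ring
  simp only [h]
  rw [integral_add .of_finite .of_finite, integral_const_mul, integral_edgeIndicator_sub he]
  simp

theorem integral_edgeIndicator_sub_edgeIndicator {e f : Sym2 V} (he : ¬ e.IsDiag)
    (hf : ¬ f.IsDiag) : ∫ G, (edgeIndicator G e - edgeIndicator G f) ∂G(V, p) = 0 := by
  rw [integral_sub .of_finite .of_finite, integral_edgeIndicator he, integral_edgeIndicator hf,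
    sub_self]

theorem integral_edgeIndicator_sub_edgeIndicator_sq {e f : Sym2 V} (he : ¬ e.IsDiag)
    (hf : ¬ f.IsDiag) (hef : e ≠ f) :
    ∫ G, (edgeIndicator G e - edgeIndicator G f) ^ 2 ∂G(V, p) = 2 * (p * (1 - p)) := by
  have h : ∀ G : SimpleGraph V, (edgeIndicator G e - edgeIndicator G f) ^ 2
      = edgeIndicator G e + edgeIndicator G f - 2 * (edgeIndicator G e * edgeIndicator G f) :=
    fun G => by
      rcases edgeIndicator_eq_zero_or_one G e with h | h <;>
        rcases edgeIndicator_eq_zero_or_one G f with h' | h' <;> rw [h, h'] <;> ring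
  simp only [h]
  rw [integral_sub .of_finite .of_finite, integral_add .of_finite .of_finite, integral_const_mul,
    DependsOnEdges.integral_mul (.edgeIndicator (Set.mem_singleton e))
      (.edgeIndicator (Set.mem_singleton f)) (by simpa using hef),
    integral_edgeIndicator he, integral_edgeIndicator hf]
  ring

theorem integral_sq_sum_of_dependsOnEdges {κ : Type*} {K : Finset κ} {S : κ → Set (Sym2 V)}
    (hS : (K : Set κ).PairwiseDisjoint S) {f : κ → SimpleGraph V → ℝ}
    (hf : ∀ x ∈ K, DependsOnEdges (f x) (S x)) (hmean : ∀ x ∈ K, ∫ G, f x G ∂G(V, p) = 0) :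
    ∫ G, (∑ x ∈ K, f x G) ^ 2 ∂G(V, p) = ∑ x ∈ K, ∫ G, f x G ^ 2 ∂G(V, p) :=
  integral_sq_sum_of_orthogonal (fun _ _ => .of_discrete) fun x hx y hy hxy => by
    rw [(hf x hx).integral_mul (hf y hy) (hS hx hy hxy), hmean x hx, zero_mul]

/-- The coefficients may be random, as long as they are determined by other edges than those
being summed: the summands are then still orthogonal. -/
theorem integral_sq_sum_mul_edgeIndicator_sub_le {κ : Type*} {K : Finset κ} {e : κ → Sym2 V}
    (he : Set.InjOn e K) (hdiag : ∀ x ∈ K, ¬ (e x).IsDiag) {S : Set (Sym2 V)}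
    (hS : ∀ x ∈ K, e x ∉ S) {c : κ → SimpleGraph V → ℝ} (hc : ∀ x ∈ K, DependsOnEdges (c x) S)
    {B : ℝ} (hB : ∀ x ∈ K, ∀ G, c x G ^ 2 ≤ B) :
    ∫ G, (∑ x ∈ K, c x G * (edgeIndicator G (e x) - p)) ^ 2 ∂G(V, p)
      ≤ K.card * (B * (p * (1 - p))) := by
  have hedge : ∀ x, DependsOnEdges (fun G => edgeIndicator G (e x) - p) {e x} := fun x =>
    (DependsOnEdges.edgeIndicator (Set.mem_singleton _)).comp (· - (p : ℝ))
  rw [integral_sq_sum_of_orthogonal (fun _ _ => .of_discrete), ← nsmul_eq_mul]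
  · refine Finset.sum_le_card_nsmul _ _ _ fun x hx => ?_
    have hcx : ∫ G, c x G ^ 2 ∂G(V, p) ≤ B :=
      (integral_mono .of_finite (integrable_const B) (hB x hx)).trans_eq (by simp)
    simp only [mul_pow]
    rw [((hc x hx).comp (· ^ 2)).integral_mul ((hedge x).comp (· ^ 2)) (by simpa using hS x hx),
      integral_edgeIndicator_sub_sq (hdiag x hx)]
    exact mul_le_mul_of_nonneg_right hcx (mul_nonneg p.2.1 (sub_nonneg.2 p.2.2))
  · intro x hx y hy hxy
    have hrest : DependsOnEdges
        (fun G => c x G * c y G * (edgeIndicator G (e x) - p)) (S ∪ {e x}) :=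
      (((hc x hx).comp₂ (hc y hy) (· * ·)).mono Set.subset_union_left).comp₂
        ((hedge x).mono Set.subset_union_right) (· * ·)
    have hdisj : Disjoint (S ∪ {e x}) {e y} := by
      simpa using ⟨fun h => hxy (he hx hy h.symm), hS y hy⟩
    have hmul := hrest.integral_mul (p := p) (hedge y) hdisj
    rw [integral_edgeIndicator_sub (hdiag y hy), mul_zero] at hmul
    rw [← hmul]
    exact integral_congr_ae (.of_forall fun G => by ring)

theorem cos_mul_add {t x y η : ℝ} (hη : η = 1 ∨ η = -1) (hy : y = 0 ∨ y = 1 ∨ y = -1) :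
    Real.cos (t * (η * y + x))
      = Real.cos (t * x) * (1 - (1 - Real.cos t) * y ^ 2)
        - η * Real.sin t * (Real.sin (t * x) * y) := by
  rw [mul_add, Real.cos_add]
  rcases hη with rfl | rfl <;> rcases hy with rfl | rfl | rfl <;> simp <;> ring

section Differences

variable {κ : Type*} {K : Finset κ} {e f : κ → Sym2 V} {η : κ → ℝ}

theorem integral_sq_sum_edgeIndicator_sub_edgeIndicator
    (hdisj : (K : Set κ).PairwiseDisjoint fun x => ({e x, f x} : Set (Sym2 V)))
    (he : ∀ x ∈ K, ¬ (e x).IsDiag) (hf : ∀ x ∈ K, ¬ (f x).IsDiag) (hef : ∀ x ∈ K, e x ≠ f x)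
    (hη : ∀ x ∈ K, η x = 1 ∨ η x = -1) :
    ∫ G, (∑ x ∈ K, η x * (edgeIndicator G (e x) - edgeIndicator G (f x))) ^ 2 ∂G(V, p)
      = K.card * (2 * (p * (1 - p))) := by
  rw [integral_sq_sum_of_dependsOnEdges hdisj, ← nsmul_eq_mul]
  · refine Finset.sum_eq_card_nsmul fun x hx => ?_
    have hsq : η x ^ 2 = 1 := sq_eq_one_iff.2 (hη x hx)
    simp only [mul_pow, hsq, one_mul]
    exact integral_edgeIndicator_sub_edgeIndicator_sq (he x hx) (hf x hx) (hef x hx)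
  · exact fun x _ => (DependsOnEdges.edgeIndicator (by simp)).comp₂
      (.edgeIndicator (by simp)) fun s t => η x * (s - t)
  · intro x hx
    rw [integral_const_mul, integral_edgeIndicator_sub_edgeIndicator (he x hx) (hf x hx), mul_zero]

/-- The sine of each summand has mean zero, so by the addition formula the expected cosine is
multiplicative. -/
theorem integral_cos_sum_edgeIndicator_sub_edgeIndicator
    (hdisj : (K : Set κ).PairwiseDisjoint fun x => ({e x, f x} : Set (Sym2 V)))
    (he : ∀ x ∈ K, ¬ (e x).IsDiag) (hf : ∀ x ∈ K, ¬ (f x).IsDiag) (hef : ∀ x ∈ K, e x ≠ f x)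
    (hη : ∀ x ∈ K, η x = 1 ∨ η x = -1) (t : ℝ) :
    ∫ G, Real.cos (t * ∑ x ∈ K, η x * (edgeIndicator G (e x) - edgeIndicator G (f x))) ∂G(V, p)
      = (1 - 2 * (p * (1 - p)) * (1 - Real.cos t)) ^ K.card := by
  classical
  induction K using Finset.induction_on with
  | empty => simp
  | insert x K hx ih =>
    simp only [Finset.mem_insert, forall_eq_or_imp] at he hf hef hη
    rw [Finset.coe_insert, Set.pairwiseDisjoint_insert_of_notMem (by simpa using hx)] at hdisj
    set X : SimpleGraph V → ℝ :=
      fun G => ∑ y ∈ K, η y * (edgeIndicator G (e y) - edgeIndicator G (f y))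
    set Y : SimpleGraph V → ℝ := fun G => edgeIndicator G (e x) - edgeIndicator G (f x)
    have hXdep : DependsOnEdges X (⋃ y ∈ K, {e y, f y}) := .sum fun y hy =>
      ((DependsOnEdges.edgeIndicator (by simp)).comp₂ (.edgeIndicator (by simp))
        fun s t => η y * (s - t)).mono
        (Set.subset_biUnion_of_mem (u := fun y => ({e y, f y} : Set (Sym2 V))) hy)
    have hYdep : DependsOnEdges Y {e x, f x} :=
      (DependsOnEdges.edgeIndicator (by simp)).comp₂ (.edgeIndicator (by simp)) (· - ·)
    have hXY : Disjoint (⋃ y ∈ K, {e y, f y}) ({e x, f x} : Set (Sym2 V)) :=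
      Set.disjoint_iUnion₂_left.2 fun y hy => (hdisj.2 y hy).symm
    have addition : ∀ G, Real.cos (t * ∑ y ∈ insert x K,
        η y * (edgeIndicator G (e y) - edgeIndicator G (f y)))
        = Real.cos (t * X G) * (1 - (1 - Real.cos t) * Y G ^ 2)
          - η x * Real.sin t * (Real.sin (t * X G) * Y G) := by
      intro G
      rw [Finset.sum_insert hx]
      refine cos_mul_add hη.1 ?_
      rcases edgeIndicator_eq_zero_or_one G (e x) with h₁ | h₁ <;>
        rcases edgeIndicator_eq_zero_or_one G (f x) with h₂ | h₂ <;> simp [h₁, h₂]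
    have hcos := (hXdep.comp fun s => Real.cos (t * s)).integral_mul (p := p)
      (hYdep.comp fun s => 1 - (1 - Real.cos t) * s ^ 2) hXY
    have hsin := (hXdep.comp fun s => Real.sin (t * s)).integral_mul (p := p) hYdep hXY
    rw [integral_edgeIndicator_sub_edgeIndicator he.1 hf.1, mul_zero] at hsin
    rw [ih hdisj.1 he.2 hf.2 hef.2 hη.2, integral_sub .of_finite .of_finite, integral_const_mul,
      integral_edgeIndicator_sub_edgeIndicator_sq he.1 hf.1 hef.1] at hcos
    simp only [addition]
    rw [integral_sub .of_finite .of_finite, integral_const_mul, hcos, hsin,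
      Finset.card_insert_of_notMem hx]
    simp only [integral_const, probReal_univ, smul_eq_mul]
    ring

end Differences

omit [Finite V] in
theorem ncard_edgeSet_comap_equiv {W : Type*} (G : SimpleGraph V) (π : W ≃ V) :
    (G.comap π).edgeSet.ncard = G.edgeSet.ncard :=
  Nat.card_congr (Iso.comap π G).mapEdgeSet

theorem measurePreserving_comap_equiv (π : V ≃ V) :
    MeasurePreserving (fun G => G.comap π) G(V, p) G(V, p) := by
  refine ⟨.of_discrete, Measure.ext_of_singleton fun G => ?_⟩
  have hpre : (fun H : SimpleGraph V => H.comap π) ⁻¹' {G} = {G.comap π.symm} := by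
    ext H
    rw [Set.mem_preimage, Set.mem_singleton_iff, Set.mem_singleton_iff]
    exact ⟨fun h => by simp [← h, comap_comap], fun h => by simp [h, comap_comap]⟩
  rw [Measure.map_apply .of_discrete .of_discrete, hpre, binomialRandom_singleton,
    binomialRandom_singleton, ncard_edgeSet_comap_equiv]

end Finite

end EdgeIndependence

/-! ### Lower bounds for the first absolute moment -/

section AbsoluteMoment

open MeasureTheory Real

theorem hasSum_one_sub_cos_div_sq {y : ℝ} (hy : y ∈ Set.Icc (0 : ℝ) 1) :
    HasSum (fun n : ℕ => (1 - cos (2 * π * n * y)) / (n : ℝ) ^ 2) (π ^ 2 * (y - y ^ 2)) := by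
  have hcos := hasSum_one_div_nat_pow_mul_cos (k := 1) one_ne_zero hy
  have hbernoulli : Polynomial.eval y ((Polynomial.bernoulli (2 * 1)).map (algebraMap ℚ ℝ))
      = y ^ 2 - y + 6⁻¹ := bernoulliFun_two y
  rw [hbernoulli] at hcos
  convert! hasSum_zeta_two.sub hcos using 1
  · funext n
    rw [mul_one]
    ring
  · norm_num [Nat.factorial]
    ring

/-- The Fourier series of the triangle wave, obtained by removing the even terms from that of a
parabola. -/
theorem hasSum_one_sub_cos_odd_div_sq {x : ℝ} (h0 : 0 ≤ x) (h1 : x ≤ π) :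
    HasSum (fun j : ℕ => (1 - cos ((2 * j + 1) * x)) / (2 * j + 1) ^ 2) (π / 4 * x) := by
  have hall := hasSum_one_sub_cos_div_sq (y := x / (2 * π))
    ⟨by positivity, by rw [div_le_one (by positivity)]; linarith⟩
  set F : ℕ → ℝ := fun n => (1 - cos (2 * π * n * (x / (2 * π)))) / (n : ℝ) ^ 2
  have heven : HasSum (fun j : ℕ => F (2 * j)) (π ^ 2 * (x / π - (x / π) ^ 2) / 4) := by
    convert! (hasSum_one_sub_cos_div_sq (y := x / π)
      ⟨by positivity, by rwa [div_le_one pi_pos]⟩).div_const 4 using 2 with j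
    change _ / _ = _
    rw [Nat.cast_mul, Nat.cast_two, mul_pow, div_div]
    congr 1
    · congr 2
      field_simp
    · ring
  have hodd : Summable fun j : ℕ => F (2 * j + 1) :=
    hall.summable.comp_injective (i := fun j : ℕ => 2 * j + 1) fun _ _ h => by simpa using h
  have hsum : ∑' j : ℕ, F (2 * j + 1) = π / 4 * x := by
    rw [eq_sub_of_add_eq' ((heven.even_add_odd hodd.hasSum).unique hall)]
    field_simp
    ring
  convert! hsum ▸ hodd.hasSum using 2 with j
  change _ = _ / _
  rw [Nat.cast_add, Nat.cast_mul, Nat.cast_two, Nat.cast_one]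
  congr 3
  field_simp

theorem sum_one_sub_cos_odd_div_sq_le (N : ℕ) (x : ℝ) :
    ∑ j ∈ Finset.range N, (1 - cos ((2 * j + 1) * x)) / (2 * (j : ℝ) + 1) ^ 2 ≤ π / 4 * |x| := by
  have hle : ∀ y : ℝ, 0 ≤ y → y ≤ π →
      ∑ j ∈ Finset.range N, (1 - cos ((2 * j + 1) * y)) / (2 * (j : ℝ) + 1) ^ 2 ≤ π / 4 * y :=
    fun y h0 h1 => sum_le_hasSum _
      (fun j _ => div_nonneg (sub_nonneg.2 (cos_le_one _)) (by positivity))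
      (hasSum_one_sub_cos_odd_div_sq h0 h1)
  have habs : ∀ j : ℕ, cos ((2 * j + 1) * x) = cos ((2 * j + 1) * |x|) := fun j => by
    rw [← cos_abs, abs_mul, abs_of_nonneg (by positivity : (0 : ℝ) ≤ 2 * j + 1)]
  simp only [habs]
  rcases le_total |x| π with h | h
  · exact hle _ (abs_nonneg x) h
  calc ∑ j ∈ Finset.range N, (1 - cos ((2 * j + 1) * |x|)) / (2 * (j : ℝ) + 1) ^ 2
      ≤ ∑ j ∈ Finset.range N, (1 - cos ((2 * j + 1) * π)) / (2 * (j : ℝ) + 1) ^ 2 := by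
        gcongr with j
        rw [show (2 * (j : ℝ) + 1) * π = π + j * (2 * π) by ring, cos_add_nat_mul_two_pi, cos_pi]
        exact neg_one_le_cos _
    _ ≤ π / 4 * π := hle π pi_nonneg le_rfl
    _ ≤ π / 4 * |x| := by gcongr

theorem one_sub_cos_le_abs (x : ℝ) : 1 - cos x ≤ |x| := by
  simpa using (le_abs_self _).trans (abs_cos_sub_cos_le 0 x)

theorem le_sq_mul_one_sub_cos {σ c : ℝ} (hσ : 100 ≤ σ) (hc0 : 0 ≤ c) (hc : c ≤ 15) :
    71 / 100 * c ^ 2 ≤ σ ^ 2 * (1 - cos (c * (6 / 5 / σ))) := by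
  set x := c * (6 / 5 / σ) with hx
  have hxσ : σ * x = 6 / 5 * c := by
    rw [hx]
    field_simp
  have hx0 : 0 ≤ x := by positivity
  have hx1 : x ≤ 18 / 100 := by nlinarith
  have hcos := (abs_le.1 (cos_bound (x := x) (by rw [abs_of_nonneg hx0]; linarith))).2
  rw [abs_of_nonneg hx0] at hcos
  calc 71 / 100 * c ^ 2 ≤ (6 / 5 * c) ^ 2 * (1 / 2 - (18 / 100) ^ 2 * (5 / 96)) := by
        nlinarith [sq_nonneg c]
    _ ≤ (σ * x) ^ 2 * (1 / 2 - x ^ 2 * (5 / 96)) := by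
        rw [hxσ]
        gcongr
    _ = σ ^ 2 * (x ^ 2 / 2 - x ^ 4 * (5 / 96)) := by ring
    _ ≤ σ ^ 2 * (1 - cos x) := by
        refine mul_le_mul_of_nonneg_left ?_ (sq_nonneg σ)
        linarith

theorem exp_neg_seventy_one_hundredths_le : exp (-(71 / 100)) ≤ 197 / 400 := by
  rw [exp_neg, inv_le_comm₀ (exp_pos _) (by norm_num)]
  refine le_trans ?_ (sum_le_exp_of_nonneg (x := 71 / 100) (by norm_num) 7)
  norm_num [Finset.sum_range_succ, Nat.factorial]

theorem exp_neg_six_le : exp (-6) ≤ 3 / 1000 := by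
  rw [exp_neg, inv_le_comm₀ (exp_pos _) (by norm_num)]
  calc (3 / 1000 : ℝ)⁻¹ ≤ 2.7 ^ 6 := by norm_num
    _ ≤ exp 1 ^ 6 := by
        gcongr
        linarith [exp_one_gt_d9]
    _ = exp 6 := by
        rw [← exp_nat_mul]
        norm_num

theorem exp_neg_one_fifth_le : exp (-(1 / 5)) ≤ 82 / 100 := by
  rw [exp_neg, inv_le_comm₀ (exp_pos _) (by norm_num)]
  refine le_trans ?_ (sum_le_exp_of_nonneg (x := 1 / 5) (by norm_num) 4)
  norm_num [Finset.sum_range_succ, Nat.factorial]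

variable {Ω : Type*} {mΩ : MeasurableSpace Ω} {μ : Measure Ω} [IsProbabilityMeasure μ]
  {X : Ω → ℝ} {σ : ℝ}

theorem integrable_cos_mul (hX : AEStronglyMeasurable X μ) (t : ℝ) :
    Integrable (fun ω => cos (t * X ω)) μ :=
  .of_bound (continuous_cos.comp_aestronglyMeasurable (hX.const_mul t)) 1
    (.of_forall fun _ => abs_cos_le_one _)

theorem one_sub_exp_le_integral_one_sub_cos (hX : AEStronglyMeasurable X μ) {t y : ℝ}
    (hcos : ∫ ω, cos (t * X ω) ∂μ ≤ exp (-(σ ^ 2 * (1 - cos t))))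
    (hy : y ≤ σ ^ 2 * (1 - cos t)) :
    1 - exp (-y) ≤ ∫ ω, (1 - cos (t * X ω)) ∂μ := by
  rw [integral_sub (integrable_const 1) (integrable_cos_mul hX t)]
  simp only [integral_const, probReal_univ, one_smul]
  linarith [exp_le_exp.2 (neg_le_neg hy)]

theorem sum_integral_one_sub_cos_odd_div_sq_le (hX : Integrable X μ) (N : ℕ) {h : ℝ}
    (hh : 0 ≤ h) :
    ∑ j ∈ Finset.range N, (∫ ω, (1 - cos ((2 * j + 1) * h * X ω)) ∂μ) / (2 * (j : ℝ) + 1) ^ 2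
      ≤ π / 4 * h * ∫ ω, |X ω| ∂μ := by
  have hint : ∀ j ∈ Finset.range N, Integrable
      (fun ω => (1 - cos ((2 * j + 1) * h * X ω)) / (2 * (j : ℝ) + 1) ^ 2) μ := fun j _ =>
    ((integrable_const 1).sub (integrable_cos_mul hX.1 _)).div_const _
  simp only [← integral_div, ← integral_const_mul]
  rw [← integral_finsetSum _ hint]
  refine integral_mono (integrable_finsetSum _ hint) (hX.abs.const_mul _) fun ω => ?_
  simpa only [mul_assoc, abs_mul, abs_of_nonneg hh] using sum_one_sub_cos_odd_div_sq_le N (h * X ω)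

theorem three_quarters_mul_le_integral_abs (hX : Integrable X μ) (hσ : 100 ≤ σ)
    (hcos : ∀ t, ∫ ω, cos (t * X ω) ∂μ ≤ exp (-(σ ^ 2 * (1 - cos t)))) :
    3 / 4 * σ ≤ ∫ ω, |X ω| ∂μ := by
  set h := 6 / 5 / σ with hh
  have hterm : ∀ j ∈ Finset.range 8,
      (1 - if j = 0 then 197 / 400 else 3 / 1000) / (2 * (j : ℝ) + 1) ^ 2
      ≤ (∫ ω, (1 - cos ((2 * j + 1) * h * X ω)) ∂μ) / (2 * (j : ℝ) + 1) ^ 2 := fun j hj => by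
    gcongr
    have hj8 : (j : ℝ) ≤ 7 := by exact_mod_cast Nat.lt_succ_iff.1 (Finset.mem_range.1 hj)
    have hexponent := le_sq_mul_one_sub_cos hσ (c := 2 * (j : ℝ) + 1) (by positivity) (by linarith)
    split_ifs with hj0
    · have := one_sub_exp_le_integral_one_sub_cos hX.1 (hcos _) hexponent
      norm_num [hj0] at this ⊢
      linarith [exp_neg_seventy_one_hundredths_le]
    · have hj1 : (1 : ℝ) ≤ j := by exact_mod_cast Nat.one_le_iff_ne_zero.2 hj0
      have := one_sub_exp_le_integral_one_sub_cos hX.1 (hcos _)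
        ((by nlinarith : (6 : ℝ) ≤ _).trans hexponent)
      linarith [exp_neg_six_le]
  have hnum : (709 / 1000 : ℝ) ≤ ∑ j ∈ Finset.range 8,
      (1 - if j = 0 then 197 / 400 else 3 / 1000) / (2 * (j : ℝ) + 1) ^ 2 := by
    norm_num [Finset.sum_range_succ]
  have hmoment : 709 / 1000 ≤ 3.1416 / 4 * h * ∫ ω, |X ω| ∂μ :=
    calc (709 / 1000 : ℝ) ≤ π / 4 * h * ∫ ω, |X ω| ∂μ := hnum.trans
          ((Finset.sum_le_sum hterm).trans
            (sum_integral_one_sub_cos_odd_div_sq_le hX 8 (by positivity)))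
      _ ≤ 3.1416 / 4 * h * ∫ ω, |X ω| ∂μ := by
          gcongr
          exact pi_lt_d4.le
  have hσ0 : 0 < σ := by linarith
  rw [hh, ← div_le_iff₀' (by positivity)] at hmoment
  refine le_trans ?_ hmoment
  rw [le_div_iff₀ (by positivity)]
  field_simp
  norm_num

theorem mul_le_integral_abs (hX : Integrable X μ) (hσ : 1 / 2 ≤ σ)
    (hcos : ∀ t, ∫ ω, cos (t * X ω) ∂μ ≤ exp (-(σ ^ 2 * (1 - cos t)))) :
    18 / 100 * σ ≤ ∫ ω, |X ω| ∂μ := by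
  have hσ0 : 0 < σ := by linarith
  have hinv : |σ⁻¹| ≤ π := by
    rw [abs_of_pos (by positivity), inv_le_comm₀ hσ0 pi_pos]
    refine le_trans ?_ hσ
    rw [inv_le_comm₀ pi_pos (by norm_num)]
    linarith [pi_gt_three]
  have hexponent : 1 / 5 ≤ σ ^ 2 * (1 - cos σ⁻¹) := by
    calc (1 / 5 : ℝ) ≤ 2 / π ^ 2 := by
          rw [div_le_div_iff₀ (by norm_num) (by positivity)]
          nlinarith [pi_gt_three, pi_lt_d2]
      _ = σ ^ 2 * (2 / π ^ 2 * σ⁻¹ ^ 2) := by field_simp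
      _ ≤ σ ^ 2 * (1 - cos σ⁻¹) := by
          gcongr
          linarith [cos_le_one_sub_mul_cos_sq hinv]
  have hmoment : ∫ ω, (1 - cos (σ⁻¹ * X ω)) ∂μ ≤ σ⁻¹ * ∫ ω, |X ω| ∂μ := by
    rw [← integral_const_mul]
    refine integral_mono ((integrable_const 1).sub (integrable_cos_mul hX.1 _))
      (hX.abs.const_mul _) fun ω => ?_
    simpa only [abs_mul, abs_of_pos (inv_pos.2 hσ0)] using one_sub_cos_le_abs (σ⁻¹ * X ω)
  have := (one_sub_exp_le_integral_one_sub_cos hX.1 (hcos _) hexponent).trans hmoment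
  rw [← div_le_iff₀' (by positivity), div_inv_eq_mul] at this
  nlinarith [exp_neg_one_fifth_le]

end AbsoluteMoment

namespace Swap

variable {n : ℕ}

/-! ### Edge sums weighted by the signs of the two parts -/

/-- The vertices `1, …, 4k`, which may be swapped. -/
def V₀ (n : ℕ) : Finset (Fin n) := Finset.univ.filter fun v => v.val < 4 * (n / 6)

/-- The vertices `4k + 1, …, 6k`, which decide the swaps. -/
def V₁ (n : ℕ) : Finset (Fin n) :=
  Finset.univ.filter fun v => 4 * (n / 6) ≤ v.val ∧ v.val < 6 * (n / 6)

/-- The unordered pairs of distinct vertices, each represented by its increasing enumeration. -/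
def pairs (n : ℕ) : Finset (Fin n × Fin n) := Finset.univ.filter fun z => z.1 < z.2

/-- The pairs of vertices other than those between `V₀` and `V₁`. -/
def otherPairs (n : ℕ) : Finset (Fin n × Fin n) := pairs n \ V₀ n ×ˢ V₁ n

theorem mem_V₀ {v : Fin n} : v ∈ V₀ n ↔ v.val < 4 * (n / 6) := by simp [V₀]

theorem mem_V₁ {v : Fin n} : v ∈ V₁ n ↔ 4 * (n / 6) ≤ v.val ∧ v.val < 6 * (n / 6) := by
  simp [V₁]

theorem mem_pairs {z : Fin n × Fin n} : z ∈ pairs n ↔ z.1 < z.2 := by simp [pairs]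

theorem product_subset_pairs : V₀ n ×ˢ V₁ n ⊆ pairs n := by
  intro z hz
  rw [Finset.mem_product, mem_V₀, mem_V₁] at hz
  rw [mem_pairs, Fin.lt_def]
  omega

theorem otherPairs_subset_pairs : otherPairs n ⊆ pairs n := Finset.sdiff_subset

theorem lt_or_even_of_mem_V₁ {v : Fin n} (hv : v ∈ V₁ n) : v.val + 1 < n ∨ n % 2 = 0 := by
  rw [mem_V₁] at hv
  omega

theorem partner_mem_V₁ {v : Fin n} (hv : v ∈ V₁ n) : partner v ∈ V₁ n := by
  have hval := partner_val v (lt_or_even_of_mem_V₁ hv)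
  rw [mem_V₁] at hv ⊢
  split_ifs at hval <;> omega

theorem spin_of_mem_V₁ (G : SimpleGraph (Fin n)) {v : Fin n} (hv : v ∈ V₁ n) :
    spin G v = parity v := spin_of_le G (mem_V₁.1 hv).1

theorem a_injective : Function.Injective (a (n := n)) := fun i j h => by
  simp only [a, Fin.mk.injEq] at h
  exact Fin.ext (by omega)

theorem b_injective : Function.Injective (b (n := n)) := fun i j h => by
  simp only [b, Fin.mk.injEq] at h
  exact Fin.ext (by omega)

theorem a_ne_b (i j : Fin (2 * (n / 6))) : (a i : Fin n) ≠ b j := fun h => by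
  simp only [a, b, Fin.mk.injEq] at h
  omega

theorem a_mem_V₀ (i : Fin (2 * (n / 6))) : (a i : Fin n) ∈ V₀ n := by
  rw [mem_V₀]
  simp only [a]
  omega

theorem b_mem_V₀ (i : Fin (2 * (n / 6))) : (b i : Fin n) ∈ V₀ n := by
  rw [mem_V₀]
  simp only [b]
  omega

theorem V₀_eq_image_union_image : V₀ n = Finset.univ.image a ∪ Finset.univ.image b := by
  ext v
  simp only [Finset.mem_union, Finset.mem_image, Finset.mem_univ, true_and, ← exists_or]
  refine ⟨fun hv => ?_, ?_⟩
  · simpa only [eq_comm] using exists_eq_a_or_eq_b (mem_V₀.1 hv)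
  · rintro ⟨i, rfl | rfl⟩
    exacts [a_mem_V₀ i, b_mem_V₀ i]

theorem sum_V₀ (f : Fin n → ℝ) : ∑ v ∈ V₀ n, f v = ∑ i, (f (a i) + f (b i)) := by
  rw [V₀_eq_image_union_image, Finset.sum_union, Finset.sum_image a_injective.injOn,
    Finset.sum_image b_injective.injOn, Finset.sum_add_distrib]
  simp only [Finset.disjoint_left, Finset.mem_image, Finset.mem_univ, true_and]
  rintro _ ⟨i, rfl⟩ ⟨j, hj⟩
  exact a_ne_b i j hj.symm

theorem sum_V₀_spin (G : SimpleGraph (Fin n)) : ∑ v ∈ V₀ n, spin G v = 0 := by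
  rw [sum_V₀]
  exact Finset.sum_eq_zero fun i _ => by rw [spin_a_eq_neg, neg_add_cancel]

theorem card_V₁ : (V₁ n).card = 2 * (n / 6) := by
  have hmap : (V₁ n).map Fin.valEmbedding = Finset.Ico (4 * (n / 6)) (6 * (n / 6)) := by
    ext v
    simp only [Finset.mem_map, mem_V₁, Fin.valEmbedding_apply, Finset.mem_Ico]
    exact ⟨fun ⟨_, hw, hv⟩ => hv ▸ hw, fun hv => ⟨⟨v, by omega⟩, hv, rfl⟩⟩
  rw [← Finset.card_map Fin.valEmbedding, hmap, Nat.card_Ico]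
  omega

theorem edgesTo_eq_sum (G : SimpleGraph (Fin n)) (v : Fin n) (S : Finset (Fin n)) :
    (edgesTo G v S : ℝ) = ∑ w ∈ S, edgeIndicator G s(v, w) := by
  classical
  rw [edgesTo, Finset.card_filter, Nat.cast_sum]
  refine Finset.sum_congr rfl fun w _ => ?_
  rw [edgeIndicator_mk, Nat.cast_ite, Nat.cast_one, Nat.cast_zero]

theorem sum_A₁_sub_sum_B₁ (f : Fin n → ℝ) :
    ∑ w ∈ A₁ n, f w - ∑ w ∈ B₁ n, f w = ∑ w ∈ V₁ n, parity w * f w := by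
  have hA : A₁ n = (V₁ n).filter fun w => w.val % 2 = 0 := by
    ext w
    simp only [A₁, V₁, label, Finset.mem_filter, Finset.mem_univ, true_and, Nat.odd_iff]
    omega
  have hB : B₁ n = (V₁ n).filter fun w => ¬ w.val % 2 = 0 := by
    ext w
    simp only [B₁, V₁, label, Finset.mem_filter, Finset.mem_univ, true_and, Nat.even_iff]
    omega
  simp only [hA, hB, parity, ite_mul, one_mul, Finset.sum_ite, neg_one_mul, Finset.sum_neg_distrib,
    sub_eq_add_neg]

/-- The difference of the degrees of `b_i` and `a_i` into `V₁`, whose vertices have weights `η`. -/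
noncomputable def degreeDiff (η : Fin n → ℝ) (i : Fin (2 * (n / 6))) (G : SimpleGraph (Fin n)) :
    ℝ :=
  ∑ w ∈ V₁ n, η w * (edgeIndicator G s(b i, w) - edgeIndicator G s(a i, w))

theorem T_eq_degreeDiff (G : SimpleGraph (Fin n)) (i : Fin (2 * (n / 6))) :
    (T G i : ℝ) = degreeDiff parity i G := by
  rw [T, degreeDiff]
  push_cast
  simp only [edgesTo_eq_sum, mul_sub, Finset.sum_sub_distrib, ← sum_A₁_sub_sum_B₁]
  ring

theorem spin_b_mul_T (G : SimpleGraph (Fin n)) (i : Fin (2 * (n / 6))) :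
    spin G (b i) * (T G i : ℝ) = |(T G i : ℝ)| := by
  rw [spin_b]
  split_ifs with h
  · rw [one_mul, abs_of_pos (by exact_mod_cast h)]
  · rw [neg_one_mul, abs_of_nonpos (by exact_mod_cast not_lt.1 h)]

theorem sum_product_spin_mul (G : SimpleGraph (Fin n)) (η : Fin n → ℝ) (p : ℝ) :
    ∑ z ∈ V₀ n ×ˢ V₁ n, spin G z.1 * (η z.2 * (edgeIndicator G s(z.1, z.2) - p))
      = ∑ i, spin G (b i) * degreeDiff η i G := by
  rw [Finset.sum_product, sum_V₀]
  refine Finset.sum_congr rfl fun i _ => ?_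
  rw [degreeDiff, Finset.mul_sum, ← Finset.sum_add_distrib]
  refine Finset.sum_congr rfl fun w _ => ?_
  dsimp only
  rw [spin_a_eq_neg]
  ring

theorem sum_product_spin_mul_spin (G : SimpleGraph (Fin n)) :
    ∑ z ∈ V₀ n ×ˢ V₁ n, spin G z.1 * spin G z.2 * edgeIndicator G s(z.1, z.2)
      = ∑ i, |(T G i : ℝ)| := by
  have h := sum_product_spin_mul G parity 0
  simp only [← T_eq_degreeDiff, spin_b_mul_T, sub_zero] at h
  rw [← h]
  refine Finset.sum_congr rfl fun z hz => ?_
  rw [spin_of_mem_V₁ G (Finset.mem_product.1 hz).2, mul_assoc]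

theorem sum_sum_eq_sum_pairs (f : Fin n → Fin n → ℝ) :
    ∑ u, ∑ v, f u v = ∑ z ∈ pairs n, (f z.1 z.2 + f z.2 z.1) + ∑ u, f u u := by
  have hgt : ∑ z ∈ pairs n, f z.2 z.1 = ∑ u, ∑ v, if v < u then f u v else 0 := by
    rw [pairs, Finset.sum_filter, Fintype.sum_prod_type_right]
  have hlt : ∑ z ∈ pairs n, f z.1 z.2 = ∑ u, ∑ v, if u < v then f u v else 0 := by
    rw [pairs, Finset.sum_filter, Fintype.sum_prod_type]
  have hdiag : ∑ u, f u u = ∑ u, ∑ v, if u = v then f u v else 0 := by simp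
  rw [Finset.sum_add_distrib, hgt, hlt, hdiag]
  simp only [← Finset.sum_add_distrib]
  refine Finset.sum_congr rfl fun u _ => Finset.sum_congr rfl fun v _ => ?_
  rcases lt_trichotomy u v with h | h | h
  · simp [h, h.ne, h.not_gt]
  · simp [h]
  · simp [h, h.ne', h.not_gt]

theorem sum_sum_mul_edgeIndicator (G : SimpleGraph (Fin n)) (f : Fin n → Fin n → ℝ) :
    ∑ u, ∑ v, f u v * edgeIndicator G s(u, v)
      = ∑ z ∈ pairs n, (f z.1 z.2 + f z.2 z.1) * edgeIndicator G s(z.1, z.2) := by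
  rw [sum_sum_eq_sum_pairs]
  simp only [edgeIndicator_self, mul_zero, Finset.sum_const_zero, add_zero]
  refine Finset.sum_congr rfl fun z _ => ?_
  rw [Sym2.eq_swap (a := z.2), add_mul]

theorem sum_pairs_eq (f : Fin n × Fin n → ℝ) :
    ∑ z ∈ pairs n, f z = ∑ z ∈ V₀ n ×ˢ V₁ n, f z + ∑ z ∈ otherPairs n, f z := by
  rw [otherPairs, add_comm, Finset.sum_sdiff product_subset_pairs]

theorem two_mul_card_pairs : (2 : ℝ) * (pairs n).card = n * (n - 1) := by
  have h := sum_sum_eq_sum_pairs (n := n) fun _ _ => 1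
  simp only [Finset.sum_const, Finset.card_univ, Fintype.card_fin, nsmul_eq_mul] at h
  linarith

theorem card_pairs_le : ((pairs n).card : ℝ) ≤ (n : ℝ) ^ 2 / 2 := by
  nlinarith [two_mul_card_pairs (n := n), (Nat.cast_nonneg n : (0 : ℝ) ≤ n)]

/-- The signs cancel on `V₀ × V₁`, and the sum over all ordered pairs is a square. -/
theorem neg_half_le_sum_otherPairs_spin_mul_spin (G : SimpleGraph (Fin n)) :
    -(n / 2 : ℝ) ≤ ∑ z ∈ otherPairs n, spin G z.1 * spin G z.2 := by
  have hall := sum_sum_eq_sum_pairs fun u v => spin G u * spin G v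
  have hbetween : ∑ z ∈ V₀ n ×ˢ V₁ n, spin G z.1 * spin G z.2 = 0 := by
    rw [Finset.sum_product, ← Finset.sum_mul_sum, sum_V₀_spin, zero_mul]
  have hdiag : ∑ u : Fin n, spin G u * spin G u = n := by
    simp only [mul_self_eq_one_iff.2 (spin_eq_one_or_neg_one G _), Finset.sum_const,
      Finset.card_univ, Fintype.card_fin, nsmul_one]
  have hsymm : ∑ z ∈ pairs n, (spin G z.1 * spin G z.2 + spin G z.2 * spin G z.1)
      = 2 * ∑ z ∈ pairs n, spin G z.1 * spin G z.2 := by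
    rw [Finset.mul_sum]
    exact Finset.sum_congr rfl fun z _ => by ring
  rw [← Finset.sum_mul_sum, hdiag, hsymm, sum_pairs_eq, hbetween] at hall
  linarith [mul_self_nonneg (∑ u, spin G u)]

theorem sum_pairs_spin_add_spin (G : SimpleGraph (Fin n)) :
    ∑ z ∈ pairs n, (spin G z.1 + spin G z.2) = (n - 1) * (n % 2 : ℕ) := by
  have h := sum_sum_eq_sum_pairs fun u _ => spin G u
  simp only [Finset.sum_const, Finset.card_univ, Fintype.card_fin, nsmul_eq_mul,
    ← Finset.mul_sum, sum_spin] at h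
  linarith

theorem sum_pairs_spin_mul_spin_ge (G : SimpleGraph (Fin n)) {p : ℝ} (hp : 0 ≤ p) :
    ∑ i, |(T G i : ℝ)|
        + ∑ z ∈ otherPairs n, spin G z.1 * spin G z.2 * (edgeIndicator G s(z.1, z.2) - p)
        - p * n / 2
      ≤ ∑ z ∈ pairs n, spin G z.1 * spin G z.2 * edgeIndicator G s(z.1, z.2) := by
  rw [sum_pairs_eq, sum_product_spin_mul_spin]
  simp only [mul_sub, Finset.sum_sub_distrib, ← Finset.sum_mul]
  linarith [mul_le_mul_of_nonneg_right (neg_half_le_sum_otherPairs_spin_mul_spin G) hp]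

theorem sum_pairs_spin_add_spin_mul (G : SimpleGraph (Fin n)) (p : ℝ) :
    ∑ z ∈ pairs n, (spin G z.1 + spin G z.2) * edgeIndicator G s(z.1, z.2)
      = ∑ z ∈ otherPairs n, (spin G z.1 + spin G z.2) * (edgeIndicator G s(z.1, z.2) - p)
        + ∑ z ∈ V₀ n ×ˢ V₁ n, parity z.2 * (edgeIndicator G s(z.1, z.2) - p)
        + ∑ i, spin G (b i) * degreeDiff 1 i G
        + p * ((n - 1) * (n % 2 : ℕ)) := by
  have hcentre : ∑ z ∈ pairs n, (spin G z.1 + spin G z.2) * edgeIndicator G s(z.1, z.2)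
      = ∑ z ∈ pairs n, (spin G z.1 + spin G z.2) * (edgeIndicator G s(z.1, z.2) - p)
        + p * ((n - 1) * (n % 2 : ℕ)) := by
    rw [← sum_pairs_spin_add_spin G, Finset.mul_sum, ← Finset.sum_add_distrib]
    exact Finset.sum_congr rfl fun z _ => by ring
  have hbetween :
      ∑ z ∈ V₀ n ×ˢ V₁ n, (spin G z.1 + spin G z.2) * (edgeIndicator G s(z.1, z.2) - p)
      = ∑ z ∈ V₀ n ×ˢ V₁ n, parity z.2 * (edgeIndicator G s(z.1, z.2) - p)
        + ∑ i, spin G (b i) * degreeDiff 1 i G := by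
    rw [← sum_product_spin_mul G 1 p, ← Finset.sum_add_distrib]
    refine Finset.sum_congr rfl fun z hz => ?_
    rw [spin_of_mem_V₁ G (Finset.mem_product.1 hz).2, Pi.one_apply]
    ring
  rw [hcentre, sum_pairs_eq, hbetween]
  ring

end Swap

namespace Swap

section Moments

open MeasureTheory ProbabilityTheory SimpleGraph unitInterval

variable {n : ℕ} {p : I}

/-! ### Second moments of the edge sums -/

theorem ne_of_mem {u v : Fin n} (hu : u ∈ V₀ n) (hv : v ∈ V₁ n) : u ≠ v := by
  rintro rfl
  rw [mem_V₀] at hu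
  rw [mem_V₁] at hv
  omega

theorem eq_and_eq_of_mk_eq_mk {u u' v v' : Fin n} (hu : u ∈ V₀ n) (hv' : v' ∈ V₁ n)
    (h : s(u, v) = s(u', v')) : u = u' ∧ v = v' :=
  (Sym2.eq_iff.1 h).resolve_right fun h => ne_of_mem hu hv' h.1

/-- The possible edges between the `i`-th pair and `V₁`. -/
def edgesAt (i : Fin (2 * (n / 6))) : Set (Sym2 (Fin n)) :=
  {e | ∃ w ∈ V₁ n, e = s(a i, w) ∨ e = s(b i, w)}

/-- The possible edges between `V₀` and `V₁`. -/
def edgesBetween (n : ℕ) : Set (Sym2 (Fin n)) := {e | ∃ u ∈ V₀ n, ∃ w ∈ V₁ n, e = s(u, w)}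

theorem edgesAt_subset (i : Fin (2 * (n / 6))) : edgesAt i ⊆ edgesBetween n := by
  rintro e ⟨w, hw, h | h⟩
  exacts [⟨_, a_mem_V₀ i, w, hw, h⟩, ⟨_, b_mem_V₀ i, w, hw, h⟩]

theorem pairwise_disjoint_edgesAt : Pairwise (Function.onFun Disjoint (edgesAt (n := n))) := by
  intro i j hij
  rw [Function.onFun, Set.disjoint_left]
  rintro e ⟨w, _, rfl | rfl⟩ ⟨w', hw', h' | h'⟩
  · exact hij (a_injective (eq_and_eq_of_mk_eq_mk (a_mem_V₀ i) hw' h').1)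
  · exact a_ne_b i j (eq_and_eq_of_mk_eq_mk (a_mem_V₀ i) hw' h').1
  · exact a_ne_b j i (eq_and_eq_of_mk_eq_mk (b_mem_V₀ i) hw' h').1.symm
  · exact hij (b_injective (eq_and_eq_of_mk_eq_mk (b_mem_V₀ i) hw' h').1)

theorem mk_notMem_edgesBetween {z : Fin n × Fin n} (hz : z ∈ otherPairs n) :
    s(z.1, z.2) ∉ edgesBetween n := by
  rintro ⟨u, hu, w, hw, h⟩
  have hlt := mem_pairs.1 (otherPairs_subset_pairs hz)
  rcases Sym2.eq_iff.1 h with ⟨rfl, rfl⟩ | ⟨rfl, rfl⟩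
  · exact (Finset.mem_sdiff.1 hz).2 (Finset.mem_product.2 ⟨hu, hw⟩)
  · exact hlt.not_gt (mem_pairs.1 (product_subset_pairs (Finset.mk_mem_product hu hw)))

theorem dependsOnEdges_degreeDiff (η : Fin n → ℝ) (i : Fin (2 * (n / 6))) :
    DependsOnEdges (degreeDiff η i) (edgesAt i) :=
  .sum fun w hw =>
    have hb : s(b i, w) ∈ edgesAt i := ⟨w, hw, Or.inr rfl⟩
    have ha : s(a i, w) ∈ edgesAt i := ⟨w, hw, Or.inl rfl⟩
    (DependsOnEdges.edgeIndicator hb).comp₂ (.edgeIndicator ha) fun x y => η w * (x - y)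

theorem dependsOnEdges_T (i : Fin (2 * (n / 6))) :
    DependsOnEdges (fun G => (T G i : ℝ)) (edgesAt i) := by
  simpa only [T_eq_degreeDiff] using dependsOnEdges_degreeDiff parity i

theorem dependsOnEdges_spin_b (i : Fin (2 * (n / 6))) :
    DependsOnEdges (fun G => spin G (b i)) (edgesAt i) := by
  simpa only [spin_b, Int.cast_pos] using
    (dependsOnEdges_T i).comp fun x => if 0 < x then (1 : ℝ) else -1

theorem dependsOnEdges_spin (v : Fin n) :
    DependsOnEdges (fun G => spin G v) (edgesBetween n) := by
  by_cases hv : v.val < 4 * (n / 6)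
  · obtain ⟨i, rfl | rfl⟩ := exists_eq_a_or_eq_b hv
    · simpa only [spin_a_eq_neg] using
        ((dependsOnEdges_spin_b i).mono (edgesAt_subset i)).comp Neg.neg
    · exact (dependsOnEdges_spin_b i).mono (edgesAt_subset i)
  · intro G H _
    simp only [spin_of_le _ (not_lt.1 hv)]

theorem pairwiseDisjoint_edges_V₁ (i : Fin (2 * (n / 6))) :
    (V₁ n : Set (Fin n)).PairwiseDisjoint
      fun w => ({s(b i, w), s(a i, w)} : Set (Sym2 (Fin n))) := by
  intro w _ w' hw' hne
  rw [Function.onFun, Set.disjoint_left]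
  rintro e (rfl | rfl) (h | h)
  exacts [hne (eq_and_eq_of_mk_eq_mk (b_mem_V₀ i) hw' h).2,
    hne (eq_and_eq_of_mk_eq_mk (b_mem_V₀ i) hw' h).2,
    hne (eq_and_eq_of_mk_eq_mk (a_mem_V₀ i) hw' h).2,
    hne (eq_and_eq_of_mk_eq_mk (a_mem_V₀ i) hw' h).2]

theorem mk_b_ne_mk_a (i : Fin (2 * (n / 6))) {w : Fin n} (hw : w ∈ V₁ n) :
    s(b i, w) ≠ s(a i, w) := fun h =>
  a_ne_b i i (eq_and_eq_of_mk_eq_mk (b_mem_V₀ i) hw h).1.symm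

theorem integral_degreeDiff_sq {η : Fin n → ℝ} (hη : ∀ w, η w = 1 ∨ η w = -1)
    (i : Fin (2 * (n / 6))) :
    ∫ G, degreeDiff η i G ^ 2 ∂G(Fin n, p) = 4 * (n / 6 : ℕ) * (p * (1 - p)) := by
  unfold degreeDiff
  rw [integral_sq_sum_edgeIndicator_sub_edgeIndicator (pairwiseDisjoint_edges_V₁ i)
    (fun w hw => Sym2.mk_isDiag_iff.not.2 (ne_of_mem (b_mem_V₀ i) hw))
    (fun w hw => Sym2.mk_isDiag_iff.not.2 (ne_of_mem (a_mem_V₀ i) hw))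
    (fun w hw => mk_b_ne_mk_a i hw) fun w _ => hη w, card_V₁]
  push_cast
  ring

theorem integral_cos_T (i : Fin (2 * (n / 6))) (t : ℝ) :
    ∫ G, Real.cos (t * T G i) ∂G(Fin n, p)
      = (1 - 2 * (p * (1 - p)) * (1 - Real.cos t)) ^ (2 * (n / 6)) := by
  simp only [T_eq_degreeDiff, degreeDiff]
  rw [integral_cos_sum_edgeIndicator_sub_edgeIndicator (pairwiseDisjoint_edges_V₁ i)
    (fun w hw => Sym2.mk_isDiag_iff.not.2 (ne_of_mem (b_mem_V₀ i) hw))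
    (fun w hw => Sym2.mk_isDiag_iff.not.2 (ne_of_mem (a_mem_V₀ i) hw))
    (fun w hw => mk_b_ne_mk_a i hw) fun w _ => parity_eq_one_or_neg_one w, card_V₁]

theorem integral_cos_T_le (i : Fin (2 * (n / 6))) (t : ℝ) :
    ∫ G, Real.cos (t * T G i) ∂G(Fin n, p)
      ≤ Real.exp (-(√(4 * (n / 6 : ℕ) * (p * (1 - p))) ^ 2 * (1 - Real.cos t))) := by
  have hq : (0 : ℝ) ≤ 1 - p := sub_nonneg.2 p.2.2
  have hpq : (0 : ℝ) ≤ p * (1 - p) := mul_nonneg p.2.1 hq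
  have hpq' : (p : ℝ) * (1 - p) ≤ 1 / 4 := by nlinarith [sq_nonneg ((p : ℝ) - 1 / 2)]
  rw [integral_cos_T, Real.sq_sqrt (by positivity)]
  calc (1 - 2 * ((p : ℝ) * (1 - p)) * (1 - Real.cos t)) ^ (2 * (n / 6))
      ≤ Real.exp (-(2 * (p * (1 - p)) * (1 - Real.cos t))) ^ (2 * (n / 6)) := by
        refine pow_le_pow_left₀ ?_ (Real.one_sub_le_exp_neg _) _
        nlinarith [Real.neg_one_le_cos t, Real.cos_le_one t]
    _ = _ := by
        rw [← Real.exp_nat_mul]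
        congr 1
        push_cast
        ring

theorem sum_second_moments (x : ℝ) :
    ∑ _i : Fin (2 * (n / 6)), 4 * (n / 6 : ℕ) * x = 8 * (n / 6 : ℕ) ^ 2 * x := by
  rw [Finset.sum_const, Finset.card_univ, Fintype.card_fin, nsmul_eq_mul]
  push_cast
  ring

theorem integral_sq_sum_abs_T_sub_le :
    ∫ G, (∑ i, (|(T G i : ℝ)| - ∫ H, |(T H i : ℝ)| ∂G(Fin n, p))) ^ 2 ∂G(Fin n, p)
      ≤ 8 * (n / 6 : ℕ) ^ 2 * (p * (1 - p)) := by
  rw [integral_sq_sum_of_dependsOnEdges (pairwise_disjoint_edgesAt.set_pairwise _)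
    (fun i _ => (dependsOnEdges_T i).comp fun x => |x| - ∫ H, |(T H i : ℝ)| ∂G(Fin n, p))
    (fun i _ => by rw [integral_sub .of_finite .of_finite]; simp), ← sum_second_moments]
  refine Finset.sum_le_sum fun i _ => ?_
  have h := variance_le_expectation_sq (μ := G(Fin n, p)) (X := fun G => |(T G i : ℝ)|)
    .of_discrete
  rw [variance_eq_integral .of_discrete] at h
  simpa only [Pi.pow_apply, sq_abs, T_eq_degreeDiff,
    integral_degreeDiff_sq parity_eq_one_or_neg_one] using h

/-- Exchanging the vertices of every pair exchanges `a_i` and `b_i`, and permutes `V₁`. -/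
theorem degreeDiff_comap_partner {η : Fin n → ℝ} {ε : ℝ}
    (hη : ∀ w ∈ V₁ n, η (partner w) = ε * η w) (i : Fin (2 * (n / 6))) (G : SimpleGraph (Fin n)) :
    degreeDiff η i (G.comap partner) = -ε * degreeDiff η i G := by
  have hcomap : ∀ u v, edgeIndicator (G.comap partner) s(u, v)
      = edgeIndicator G s(partner u, partner v) := fun u v => by
    classical simp only [edgeIndicator_mk, comap_adj]
  simp only [degreeDiff, hcomap, partner_a, partner_b, Finset.mul_sum]
  refine Finset.sum_nbij' partner partner (fun _ => partner_mem_V₁) (fun _ => partner_mem_V₁)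
    (fun w _ => partner_involutive w) (fun w _ => partner_involutive w) fun w hw => ?_
  have hηw := hη (partner w) (partner_mem_V₁ hw)
  rw [partner_involutive] at hηw
  rw [hηw]
  ring

theorem T_comap_partner (i : Fin (2 * (n / 6))) (G : SimpleGraph (Fin n)) :
    T (G.comap partner) i = T G i := by
  have h := degreeDiff_comap_partner (η := parity) (ε := -1)
    (fun w hw => by rw [parity_partner (lt_or_even_of_mem_V₁ hw), neg_one_mul]) i G
  rw [← T_eq_degreeDiff, ← T_eq_degreeDiff, neg_neg, one_mul] at h
  exact_mod_cast h

theorem integral_spin_b_mul_degreeDiff_one (i : Fin (2 * (n / 6))) :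
    ∫ G, spin G (b i) * degreeDiff 1 i G ∂G(Fin n, p) = 0 := by
  have hodd : ∀ G : SimpleGraph (Fin n), spin (G.comap partner) (b i)
      * degreeDiff 1 i (G.comap partner) = -(spin G (b i) * degreeDiff 1 i G) := fun G => by
    rw [degreeDiff_comap_partner (ε := 1) (fun w _ => by simp), spin_b, T_comap_partner, ← spin_b]
    ring
  have hmp := measurePreserving_comap_equiv (p := p) (partner_involutive (n := n)).toPerm
  have h := integral_map hmp.aemeasurable (f := fun G => spin G (b i) * degreeDiff 1 i G)
    .of_discrete
  rw [hmp.map_eq] at h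
  simp only [Function.Involutive.coe_toPerm, hodd, integral_neg] at h
  linarith

theorem integral_sq_sum_spin_b_mul_degreeDiff_one :
    ∫ G, (∑ i, spin G (b i) * degreeDiff 1 i G) ^ 2 ∂G(Fin n, p)
      = 8 * (n / 6 : ℕ) ^ 2 * (p * (1 - p)) := by
  rw [integral_sq_sum_of_dependsOnEdges (pairwise_disjoint_edgesAt.set_pairwise _)
    (fun i _ => (dependsOnEdges_spin_b i).comp₂ (dependsOnEdges_degreeDiff 1 i) (· * ·))
    (fun i _ => integral_spin_b_mul_degreeDiff_one i), ← sum_second_moments]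
  refine Finset.sum_congr rfl fun i _ => ?_
  simp only [mul_pow, sq_eq_one_iff.2 (spin_eq_one_or_neg_one _ _), one_mul]
  exact integral_degreeDiff_sq (fun _ => Or.inl rfl) i

theorem integral_sq_sum_pairs_le {K : Finset (Fin n × Fin n)} (hK : K ⊆ pairs n)
    {S : Set (Sym2 (Fin n))} (hS : ∀ z ∈ K, s(z.1, z.2) ∉ S)
    {c : Fin n × Fin n → SimpleGraph (Fin n) → ℝ} (hc : ∀ z, DependsOnEdges (c z) S)
    {B : ℝ} (hB : ∀ z G, c z G ^ 2 ≤ B) (hB₀ : 0 ≤ B) :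
    ∫ G, (∑ z ∈ K, c z G * (edgeIndicator G s(z.1, z.2) - p)) ^ 2 ∂G(Fin n, p)
      ≤ n ^ 2 / 2 * (B * (p * (1 - p))) := by
  have hlt : ∀ z ∈ K, z.1 < z.2 := fun z hz => mem_pairs.1 (hK hz)
  have hinj : Set.InjOn (fun z : Fin n × Fin n => s(z.1, z.2)) K := fun z hz z' hz' h => by
    rcases Sym2.eq_iff.1 h with h | h
    · exact Prod.ext h.1 h.2
    · exact absurd (h.1 ▸ h.2 ▸ hlt z hz) (hlt z' hz').not_gt
  have hq : (0 : ℝ) ≤ 1 - p := sub_nonneg.2 p.2.2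
  have hp : (0 : ℝ) ≤ p := p.2.1
  refine (integral_sq_sum_mul_edgeIndicator_sub_le hinj
    (fun z hz => Sym2.mk_isDiag_iff.not.2 (hlt z hz).ne) hS (fun z _ => hc z)
    fun z _ => hB z).trans ?_
  have hcard : (K.card : ℝ) ≤ n ^ 2 / 2 :=
    le_trans (by exact_mod_cast Finset.card_le_card hK) card_pairs_le
  gcongr

end Moments

end Swap

/-! ### Modularity with high probability -/

section Whp

open MeasureTheory Filter Topology

theorem measureReal_le_of_integral_le {Ω : Type*} {_ : MeasurableSpace Ω} {μ : Measure Ω}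
    {f : Ω → ℝ} (hf : Integrable f μ) (hf₀ : 0 ≤ f) {t C : ℝ} (ht : 0 < t)
    (h : ∫ ω, f ω ∂μ ≤ t * C) : μ.real {ω | t ≤ f ω} ≤ C :=
  le_of_mul_le_mul_left
    ((mul_meas_ge_le_integral_of_nonneg (.of_forall hf₀) hf t).trans h) ht

theorem measureReal_le_abs_of_integral_sq_le {Ω : Type*} {mΩ : MeasurableSpace Ω} {μ : Measure Ω}
    {f : Ω → ℝ} (hf : Integrable (fun ω => f ω ^ 2) μ) {t C : ℝ} (ht : 0 < t)
    (h : ∫ ω, f ω ^ 2 ∂μ ≤ t ^ 2 * C) : μ.real {ω | t ≤ |f ω|} ≤ C := by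
  have hsq := measureReal_le_of_integral_le hf (fun ω => sq_nonneg (f ω)) (sq_pos_of_pos ht) h
  simpa only [sq_le_sq, abs_of_pos ht] using hsq

theorem tendsto_measure_one_of_measureReal_compl_le {Ω : ℕ → Type*}
    {mΩ : ∀ n, MeasurableSpace (Ω n)} {μ : ∀ n, Measure (Ω n)} [∀ n, IsProbabilityMeasure (μ n)]
    {S : ∀ n, Set (Ω n)} (hS : ∀ n, MeasurableSet (S n)) {C : ℝ}
    (h : ∀ᶠ n : ℕ in atTop, (μ n).real (S n)ᶜ ≤ C / n) :
    Tendsto (fun n => μ n (S n)) atTop (𝓝 1) := by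
  have hlim : Tendsto (fun n => (μ n).real (S n)ᶜ) atTop (𝓝 0) :=
    squeeze_zero' (.of_forall fun _ => measureReal_nonneg) h
      (tendsto_const_div_atTop_nhds_zero_nat C)
  have hlim' := ENNReal.tendsto_ofReal (hlim.const_sub 1)
  simpa only [probReal_compl_eq_one_sub (hS _), sub_sub_cancel,
    ofReal_measureReal (measure_ne_top _ _), sub_zero, ENNReal.ofReal_one] using hlim'

end Whp

namespace Swap

section Whp

open MeasureTheory SimpleGraph unitInterval

variable {n : ℕ} {p : I}

/-- The order of magnitude `n (n p (1 - p)) ^ (1 / 2)` of what swapping gains in edges. -/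
noncomputable def gain (n : ℕ) (p : I) : ℝ := n * √(n * (p * (1 - p)))

theorem mul_one_sub_nonneg (p : I) : (0 : ℝ) ≤ p * (1 - p) :=
  mul_nonneg p.2.1 (sub_nonneg.2 p.2.2)

theorem pos_of_one_le_mul (hp : 1 ≤ (n : ℝ) * p) : (0 : ℝ) < p :=
  pos_of_mul_pos_right (by linarith) n.cast_nonneg

theorem le_cast_of_le_mul_one_sub {x : ℝ} (hq : x ≤ n * (1 - p)) : x ≤ n :=
  hq.trans (mul_le_of_le_one_right n.cast_nonneg (by linarith [p.2.1]))

theorem half_mul_le_mul_mul_one_sub {x : ℝ} (hp : x ≤ n * p) (hq : x ≤ n * (1 - p)) :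
    x / 2 ≤ n * (p * (1 - p)) := by
  have hp₀ := p.2.1
  have hp₁ := p.2.2
  have : (0 : ℝ) ≤ n := n.cast_nonneg
  rcases le_total (p : ℝ) (1 / 2) with _ | _ <;> nlinarith

theorem sq_gain : gain n p ^ 2 = n ^ 3 * (p * (1 - p)) := by
  rw [gain, mul_pow, Real.sq_sqrt (mul_nonneg n.cast_nonneg (mul_one_sub_nonneg p))]
  ring

theorem half_le_gain (hp : 1 ≤ (n : ℝ) * p) (hq : 10 ^ 8 ≤ (n : ℝ) * (1 - p)) :
    (n : ℝ) / 2 ≤ gain n p := by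
  have h : 1 / 2 ≤ √(n * (p * (1 - p))) :=
    Real.le_sqrt_of_sq_le (by linarith [half_mul_le_mul_mul_one_sub hp (by linarith)])
  rw [gain]
  linarith [mul_le_mul_of_nonneg_left h (n.cast_nonneg : (0 : ℝ) ≤ n)]

theorem mul_le_gain (hq : 10 ^ 8 ≤ (n : ℝ) * (1 - p)) : (p : ℝ) * n ≤ 1 / 10000 * gain n p := by
  have h : (10 ^ 4 : ℝ) * p ≤ √(n * (p * (1 - p))) :=
    Real.le_sqrt_of_sq_le (by nlinarith [p.2.1, p.2.2])
  rw [gain]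
  linarith [mul_le_mul_of_nonneg_left h (n.cast_nonneg : (0 : ℝ) ≤ n)]

theorem cast_le_six_mul_add_five (n : ℕ) : (n : ℝ) ≤ 6 * (n / 6 : ℕ) + 5 := by
  exact_mod_cast (by omega : n ≤ 6 * (n / 6) + 5)

theorem le_two_mul_mul_sqrt (hn : (10 ^ 5 : ℝ) ≤ n) :
    2719 / 10000 * gain n p ≤ 2 * (n / 6 : ℕ) * √(4 * (n / 6 : ℕ) * (p * (1 - p))) := by
  have hpq := mul_one_sub_nonneg p
  have hk : (n : ℝ) * (9999 / 60000) ≤ (n / 6 : ℕ) := by linarith [cast_le_six_mul_add_five n]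
  have hs : 8163 / 10000 * √(n * (p * (1 - p))) ≤ √(4 * (n / 6 : ℕ) * (p * (1 - p))) := by
    apply Real.le_sqrt_of_sq_le
    rw [mul_pow, Real.sq_sqrt (by positivity)]
    nlinarith
  have hgain : 0 ≤ gain n p := by unfold gain; positivity
  calc 2719 / 10000 * gain n p
      ≤ 2 * ((n : ℝ) * (9999 / 60000)) * (8163 / 10000 * √(n * (p * (1 - p)))) := by
        unfold gain at hgain ⊢
        linarith
    _ ≤ _ := by gcongr

theorem sqrt_eq_gain_div (hp : 1 ≤ (n : ℝ) * p) :
    √((1 - (p : ℝ)) / (n * p)) = gain n p / (p * n ^ 2) := by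
  have hnp : (0 : ℝ) < n * p := by linarith
  have hn : (n : ℝ) ≠ 0 := (pos_of_mul_pos_left hnp p.2.1).ne'
  have hp₀ : (p : ℝ) ≠ 0 := (pos_of_one_le_mul hp).ne'
  have h : (1 - (p : ℝ)) / (n * p) = n * (p * (1 - p)) / (n * p) ^ 2 := by field_simp
  rw [gain, h, Real.sqrt_div' _ (sq_nonneg _), Real.sqrt_sq hnp.le]
  field_simp

/-- The number of edges minus its mean. -/
noncomputable def edgeDeviation (p : I) (G : SimpleGraph (Fin n)) : ℝ :=
  ∑ z ∈ pairs n, (edgeIndicator G s(z.1, z.2) - p)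

/-- The sum of the `|T_i|` minus its mean. -/
noncomputable def gainDeviation (p : I) (G : SimpleGraph (Fin n)) : ℝ :=
  ∑ i, (|(T G i : ℝ)| - ∫ H, |(T H i : ℝ)| ∂G(Fin n, p))

/-- The signed sum over the edges which are not between `V₀` and `V₁`, centred. -/
noncomputable def otherDeviation (p : I) (G : SimpleGraph (Fin n)) : ℝ :=
  ∑ z ∈ otherPairs n, spin G z.1 * spin G z.2 * (edgeIndicator G s(z.1, z.2) - p)

/-- The difference `vol(A') - vol(B')` of the volumes of the two parts. -/
noncomputable def volumeDiff (G : SimpleGraph (Fin n)) : ℝ :=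
  ∑ z ∈ pairs n, (spin G z.1 + spin G z.2) * edgeIndicator G s(z.1, z.2)

theorem sum_sum_edgeIndicator (p : I) (G : SimpleGraph (Fin n)) :
    ∑ u, ∑ v, edgeIndicator G s(u, v) = 2 * edgeDeviation p G + (p * n ^ 2 - p * n) := by
  have h := sum_sum_mul_edgeIndicator G fun _ _ => 1
  simp only [one_mul, ← Finset.mul_sum] at h
  rw [h, edgeDeviation, Finset.sum_sub_distrib, Finset.sum_const, nsmul_eq_mul]
  linear_combination p * two_mul_card_pairs (n := n)

theorem modularityScore_partition_eq (hn : 2 ≤ n) (p : I) (G : SimpleGraph (Fin n)) :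
    modularityScore G (partition G) = 1 / (2 * (2 * edgeDeviation p G + (p * n ^ 2 - p * n))) *
      (2 * ∑ z ∈ pairs n, spin G z.1 * spin G z.2 * edgeIndicator G s(z.1, z.2)
        - volumeDiff G ^ 2 / (2 * edgeDeviation p G + (p * n ^ 2 - p * n))) := by
  rw [modularityScore_partition hn G (sum_sum_edgeIndicator p G),
    sum_sum_mul_edgeIndicator G fun u v => spin G u * spin G v,
    sum_sum_mul_edgeIndicator G fun u _ => spin G u, volumeDiff, Finset.mul_sum]
  congr! 3
  ring

theorem sum_integral_abs_T_ge (hn : (10 ^ 5 : ℝ) ≤ n) {β : ℝ} (hβ : 0 ≤ β)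
    (hμ : ∀ i : Fin (2 * (n / 6)),
      β * √(4 * (n / 6 : ℕ) * (p * (1 - p))) ≤ ∫ H, |(T H i : ℝ)| ∂G(Fin n, p)) :
    β * (2719 / 10000 * gain n p)
      ≤ ∑ i : Fin (2 * (n / 6)), ∫ H, |(T H i : ℝ)| ∂G(Fin n, p) :=
  calc β * (2719 / 10000 * gain n p)
      ≤ β * (2 * (n / 6 : ℕ) * √(4 * (n / 6 : ℕ) * (p * (1 - p)))) := by
        exact mul_le_mul_of_nonneg_left (le_two_mul_mul_sqrt hn) hβ
    _ = ∑ _i : Fin (2 * (n / 6)), β * √(4 * (n / 6 : ℕ) * (p * (1 - p))) := by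
        rw [Finset.sum_const, Finset.card_univ, Fintype.card_fin, nsmul_eq_mul]
        push_cast
        ring
    _ ≤ _ := Finset.sum_le_sum fun i _ => hμ i

theorem sum_pairs_spin_mul_spin_mul_ge (hq : 10 ^ 8 ≤ (n : ℝ) * (1 - p)) {β : ℝ} (hβ : 0 ≤ β)
    (hμ : ∀ i : Fin (2 * (n / 6)),
      β * √(4 * (n / 6 : ℕ) * (p * (1 - p))) ≤ ∫ H, |(T H i : ℝ)| ∂G(Fin n, p))
    {G : SimpleGraph (Fin n)} (hT : |gainDeviation p G| < 1 / 10000 * gain n p)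
    (hO : |otherDeviation p G| < 1 / 10000 * gain n p) :
    (2719 / 10000 * β - 5 / 20000) * gain n p
      ≤ ∑ z ∈ pairs n, spin G z.1 * spin G z.2 * edgeIndicator G s(z.1, z.2) := by
  have hsum := sum_pairs_spin_mul_spin_ge G p.2.1
  have hT' := (abs_lt.1 hT).1
  have hO' := (abs_lt.1 hO).1
  rw [gainDeviation, Finset.sum_sub_distrib] at hT'
  rw [otherDeviation] at hO'
  have hmean := sum_integral_abs_T_ge (by linarith [le_cast_of_le_mul_one_sub hq]) hβ hμ
  have hdiag := mul_le_gain hq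
  linarith

/-- The numerical slack: `2719 / 10000` exceeds `4 / 15` by enough to absorb all error terms. -/
theorem modularityScore_partition_ge (hp : 1 ≤ (n : ℝ) * p) (hq : 10 ^ 8 ≤ (n : ℝ) * (1 - p))
    {β : ℝ} (hβ : 18 / 100 ≤ β)
    (hμ : ∀ i : Fin (2 * (n / 6)),
      β * √(4 * (n / 6 : ℕ) * (p * (1 - p))) ≤ ∫ H, |(T H i : ℝ)| ∂G(Fin n, p))
    {G : SimpleGraph (Fin n)} (hX : |edgeDeviation p G| < 1 / 10000 * (p * n ^ 2))
    (hT : |gainDeviation p G| < 1 / 10000 * gain n p)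
    (hO : |otherDeviation p G| < 1 / 10000 * gain n p)
    (hD : volumeDiff G ^ 2 < 1 / 10000 * (p * n ^ 2) * gain n p) :
    4 / 15 * β * √((1 - (p : ℝ)) / (n * p)) ≤ modularityScore G (partition G) := by
  have : (10 ^ 8 : ℝ) ≤ n := le_cast_of_le_mul_one_sub hq
  have hp₀ := pos_of_one_le_mul hp
  have hgain := half_le_gain hp hq
  have hS := sum_pairs_spin_mul_spin_mul_ge hq (by linarith) hμ hT hO
  have hn₂ : 2 ≤ n := by exact_mod_cast (by linarith : (2 : ℝ) ≤ n)
  rw [modularityScore_partition_eq hn₂ p G, sqrt_eq_gain_div hp]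
  set S := ∑ z ∈ pairs n, spin G z.1 * spin G z.2 * edgeIndicator G s(z.1, z.2)
  set Λ := gain n p
  set R : ℝ := p * n ^ 2
  set M := 2 * edgeDeviation p G + (R - p * n)
  have hR : 0 < R := by positivity
  have hΛ : 0 ≤ Λ := by linarith
  have : 0 ≤ β := by linarith
  have : 0 ≤ (p : ℝ) * n := by positivity
  have hpn : (p : ℝ) * n ≤ 1 / 10000 * R := by
    simp only [R]
    nlinarith
  obtain ⟨hX₁, hX₂⟩ := abs_lt.1 hX
  have hM_le : M ≤ 10002 / 10000 * R := by linarith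
  have hM : 0 < M := by linarith
  have hDM : volumeDiff G ^ 2 / M ≤ 2 / 10000 * Λ := by
    rw [div_le_iff₀ hM]
    nlinarith
  have hnum : 2 * (10002 / 10000) * (4 / 15 * β) * Λ ≤ 2 * S - volumeDiff G ^ 2 / M := by
    nlinarith
  rw [one_div, inv_mul_eq_div, le_div_iff₀ (by positivity)]
  calc 4 / 15 * β * (Λ / R) * (2 * M)
      ≤ 4 / 15 * β * (Λ / R) * (2 * (10002 / 10000 * R)) := by gcongr
    _ = 2 * (10002 / 10000) * (4 / 15 * β) * Λ := by field_simp
    _ ≤ _ := hnum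

theorem eight_mul_sq_le (n : ℕ) : 8 * ((n / 6 : ℕ) : ℝ) ^ 2 ≤ n ^ 2 / 2 := by
  have h : ((n / 6 : ℕ) : ℝ) ^ 2 ≤ (n / 6) ^ 2 := by
    gcongr
    exact Nat.cast_div_le
  nlinarith [sq_nonneg (n : ℝ)]

theorem integral_edgeDeviation_sq_le :
    ∫ G, edgeDeviation p G ^ 2 ∂G(Fin n, p) ≤ n ^ 2 / 2 * (p * (1 - p)) := by
  simpa only [edgeDeviation, one_mul] using
    integral_sq_sum_pairs_le (p := p) (Finset.Subset.refl (pairs n))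
    (fun z _ => Set.notMem_empty _) (c := fun _ _ => 1) (fun _ _ _ _ => rfl)
    (fun _ _ => (one_pow 2).le) zero_le_one

theorem integral_gainDeviation_sq_le :
    ∫ G, gainDeviation p G ^ 2 ∂G(Fin n, p) ≤ n ^ 2 / 2 * (p * (1 - p)) :=
  integral_sq_sum_abs_T_sub_le.trans
    (mul_le_mul_of_nonneg_right (eight_mul_sq_le n) (mul_one_sub_nonneg p))

theorem integral_otherDeviation_sq_le :
    ∫ G, otherDeviation p G ^ 2 ∂G(Fin n, p) ≤ n ^ 2 / 2 * (p * (1 - p)) := by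
  simpa only [otherDeviation, one_mul] using integral_sq_sum_pairs_le (p := p)
    (otherPairs_subset_pairs (n := n)) (fun z => mk_notMem_edgesBetween)
    (c := fun z G => spin G z.1 * spin G z.2)
    (fun z => (dependsOnEdges_spin z.1).comp₂ (dependsOnEdges_spin z.2) (· * ·))
    (fun z G => by
      simp only [mul_pow, sq_eq_one_iff.2 (spin_eq_one_or_neg_one G _), one_mul, le_refl])
    zero_le_one

theorem volumeDiff_sq_le (p : I) (G : SimpleGraph (Fin n)) :
    volumeDiff G ^ 2
      ≤ 4 * (∑ z ∈ otherPairs n,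
          (spin G z.1 + spin G z.2) * (edgeIndicator G s(z.1, z.2) - p)) ^ 2
        + 4 * (∑ z ∈ V₀ n ×ˢ V₁ n, parity z.2 * (edgeIndicator G s(z.1, z.2) - p)) ^ 2
        + 4 * (∑ i, spin G (b i) * degreeDiff 1 i G) ^ 2
        + 4 * (p ^ 2 * n ^ 2) := by
  have hodd : (p * (((n : ℝ) - 1) * (n % 2 : ℕ))) ^ 2 ≤ p ^ 2 * n ^ 2 := by
    rw [mul_pow]
    gcongr ?_ * ?_
    rcases Nat.mod_two_eq_zero_or_one n with h | h
    · simp [h]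
    · have hn : (1 : ℝ) ≤ n := by exact_mod_cast (by omega : 1 ≤ n)
      rw [h, Nat.cast_one, mul_one]
      nlinarith
  rw [volumeDiff, sum_pairs_spin_add_spin_mul G p]
  set x := ∑ z ∈ otherPairs n, (spin G z.1 + spin G z.2) * (edgeIndicator G s(z.1, z.2) - p)
  set y := ∑ z ∈ V₀ n ×ˢ V₁ n, parity z.2 * (edgeIndicator G s(z.1, z.2) - p)
  set u := ∑ i, spin G (b i) * degreeDiff 1 i G
  set v := (p : ℝ) * (((n : ℝ) - 1) * (n % 2 : ℕ))
  have hsplit : (x + y + u + v) ^ 2 ≤ 4 * x ^ 2 + 4 * y ^ 2 + 4 * u ^ 2 + 4 * v ^ 2 := by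
    rw [add_assoc (x + y)]
    linarith [add_sq_le (a := x + y) (b := u + v), add_sq_le (a := x) (b := y),
      add_sq_le (a := u) (b := v)]
  linarith

theorem integral_volumeDiff_sq_le :
    ∫ G, volumeDiff G ^ 2 ∂G(Fin n, p) ≤ 16 * (p * n ^ 2) := by
  have hother := integral_sq_sum_pairs_le (p := p) (otherPairs_subset_pairs (n := n))
    (fun z => mk_notMem_edgesBetween) (c := fun z G => spin G z.1 + spin G z.2)
    (fun z => (dependsOnEdges_spin z.1).comp₂ (dependsOnEdges_spin z.2) (· + ·)) (B := 4)
    (fun z G => by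
      rcases spin_eq_one_or_neg_one G z.1 with h | h <;>
        rcases spin_eq_one_or_neg_one G z.2 with h' | h' <;> norm_num [h, h'])
    (by norm_num)
  have hbetween := integral_sq_sum_pairs_le (p := p) (product_subset_pairs (n := n))
    (fun z _ => Set.notMem_empty _) (c := fun z _ => parity z.2) (fun _ _ _ _ => rfl)
    (fun z _ => (sq_eq_one_iff.2 (parity_eq_one_or_neg_one z.2)).le) zero_le_one
  have hdegree := integral_sq_sum_spin_b_mul_degreeDiff_one (n := n) (p := p)
  have hk := mul_le_mul_of_nonneg_right (eight_mul_sq_le n) (mul_one_sub_nonneg p)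
  have hp₀ := p.2.1
  refine (integral_mono .of_finite .of_finite (volumeDiff_sq_le p)).trans ?_
  rw [integral_add .of_finite .of_finite, integral_add .of_finite .of_finite,
    integral_add .of_finite .of_finite]
  simp only [integral_const_mul, integral_const, probReal_univ, one_smul]
  have hR : (0 : ℝ) ≤ p * n ^ 2 := by positivity
  have hR' : (0 : ℝ) ≤ p ^ 2 * n ^ 2 := by positivity
  linarith

theorem measureReal_gain_le_abs_le (hn : 0 < n) (hgain : 0 < gain n p)
    {f : SimpleGraph (Fin n) → ℝ}
    (hf : ∫ G, f G ^ 2 ∂G(Fin n, p) ≤ n ^ 2 / 2 * (p * (1 - p))) :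
    G(Fin n, p).real {G | 1 / 10000 * gain n p ≤ |f G|} ≤ 10 ^ 8 / n := by
  refine measureReal_le_abs_of_integral_sq_le .of_finite (by positivity) (hf.trans ?_)
  have : (0 : ℝ) < n := Nat.cast_pos.2 hn
  have hpq := mul_one_sub_nonneg p
  calc (n : ℝ) ^ 2 / 2 * (p * (1 - p)) ≤ n ^ 2 * (p * (1 - p)) := by
        gcongr
        linarith [sq_nonneg (n : ℝ)]
    _ = (1 / 10000 * gain n p) ^ 2 * (10 ^ 8 / n) := by
        rw [mul_pow, sq_gain]
        field_simp
        norm_num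

theorem measureReal_le_abs_edgeDeviation_le (hp : 1 ≤ (n : ℝ) * p) :
    G(Fin n, p).real {G | 1 / 10000 * ((p : ℝ) * n ^ 2) ≤ |edgeDeviation p G|} ≤ 10 ^ 8 / n := by
  have hp₀ := pos_of_one_le_mul hp
  have hn : (0 : ℝ) < n := pos_of_mul_pos_left (by linarith) hp₀.le
  refine measureReal_le_abs_of_integral_sq_le .of_finite (by positivity)
    (integral_edgeDeviation_sq_le.trans ?_)
  calc (n : ℝ) ^ 2 / 2 * (p * (1 - p)) = n ^ 2 * p * ((1 - p) / 2) := by ring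
    _ ≤ (n : ℝ) ^ 2 * p * (n * p) := by
        gcongr
        linarith
    _ = (1 / 10000 * ((p : ℝ) * n ^ 2)) ^ 2 * (10 ^ 8 / n) := by
        field_simp
        norm_num

theorem measureReal_le_volumeDiff_sq_le (hp : 1 ≤ (n : ℝ) * p)
    (hq : 10 ^ 8 ≤ (n : ℝ) * (1 - p)) :
    G(Fin n, p).real {G | 1 / 10000 * ((p : ℝ) * n ^ 2) * gain n p ≤ volumeDiff G ^ 2}
      ≤ 10 ^ 8 / n := by
  have hp₀ := pos_of_one_le_mul hp
  have hn : (0 : ℝ) < n := pos_of_mul_pos_left (by linarith) hp₀.le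
  have hgain := half_le_gain hp hq
  have hgain₀ : 0 < gain n p := by linarith
  refine measureReal_le_of_integral_le .of_finite (fun G => sq_nonneg (volumeDiff G))
    (by positivity) (integral_volumeDiff_sq_le.trans ?_)
  calc 16 * ((p : ℝ) * n ^ 2) ≤ 10 ^ 4 * p * n * (n / 2) := by
        linarith [mul_pos hp₀ (pow_pos hn 2)]
    _ ≤ 10 ^ 4 * (p : ℝ) * n * gain n p := by gcongr
    _ = 1 / 10000 * ((p : ℝ) * n ^ 2) * gain n p * (10 ^ 8 / n) := by
        field_simp
        norm_num

theorem measureReal_modularityScore_lt_le (hp : 1 ≤ (n : ℝ) * p)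
    (hq : 10 ^ 8 ≤ (n : ℝ) * (1 - p)) {β : ℝ} (hβ : 18 / 100 ≤ β)
    (hμ : ∀ i : Fin (2 * (n / 6)),
      β * √(4 * (n / 6 : ℕ) * (p * (1 - p))) ≤ ∫ H, |(T H i : ℝ)| ∂G(Fin n, p)) :
    G(Fin n, p).real {G | 4 / 15 * β * √((1 - (p : ℝ)) / (n * p))
      ≤ modularityScore G (partition G)}ᶜ ≤ 4 * 10 ^ 8 / n := by
  have hn : (0 : ℝ) < n := by linarith [le_cast_of_le_mul_one_sub hq]
  have hgain : 0 < gain n p := by linarith [half_le_gain hp hq]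
  have hX := measureReal_le_abs_edgeDeviation_le hp
  have hT := measureReal_gain_le_abs_le (Nat.cast_pos.1 hn) hgain
    (integral_gainDeviation_sq_le (p := p))
  have hO := measureReal_gain_le_abs_le (Nat.cast_pos.1 hn) hgain
    (integral_otherDeviation_sq_le (p := p))
  have hD := measureReal_le_volumeDiff_sq_le hp hq
  calc _ ≤ G(Fin n, p).real ({G | 1 / 10000 * ((p : ℝ) * n ^ 2) ≤ |edgeDeviation p G|} ∪
          {G | 1 / 10000 * gain n p ≤ |gainDeviation p G|} ∪
          {G | 1 / 10000 * gain n p ≤ |otherDeviation p G|} ∪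
          {G | 1 / 10000 * ((p : ℝ) * n ^ 2) * gain n p ≤ volumeDiff G ^ 2}) := by
        refine measureReal_mono (Set.compl_subset_comm.1 fun G hG => ?_)
        simp only [Set.mem_compl_iff, Set.mem_union, Set.mem_ofPred_eq, not_or, not_le] at hG
        exact modularityScore_partition_ge hp hq hβ hμ hG.1.1.1 hG.1.1.2 hG.1.2 hG.2
    _ ≤ 10 ^ 8 / n + 10 ^ 8 / n + 10 ^ 8 / n + 10 ^ 8 / n :=
        (measureReal_union_le _ _).trans <| add_le_add ((measureReal_union_le _ _).trans <|
          add_le_add ((measureReal_union_le _ _).trans <| add_le_add hX hT) hO) hD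
    _ = 4 * 10 ^ 8 / n := by ring

theorem tendsto_modularityScore_partition_ge {p : ℕ → I} {β : ℝ} (hβ : 18 / 100 ≤ β)
    (h : ∀ᶠ n : ℕ in Filter.atTop, 1 ≤ (n : ℝ) * p n ∧ 10 ^ 8 ≤ (n : ℝ) * (1 - p n) ∧
      ∀ i : Fin (2 * (n / 6)),
        β * √(4 * (n / 6 : ℕ) * (p n * (1 - p n))) ≤ ∫ H, |(T H i : ℝ)| ∂G(Fin n, p n)) :
    Filter.Tendsto (fun n : ℕ => G(Fin n, p n) {G | 4 / 15 * β * √((1 - (p n : ℝ)) / (n * p n))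
      ≤ modularityScore G (partition G)}) Filter.atTop (nhds 1) :=
  tendsto_measure_one_of_measureReal_compl_le (fun _ => .of_discrete) <|
    h.mono fun _ ⟨hp, hq, hμ⟩ => measureReal_modularityScore_lt_le hp hq hβ hμ

theorem div_four_le_mul_mul {x : ℝ} (hp : x ≤ n * p) (hq : 10 ^ 8 ≤ (n : ℝ) * (1 - p))
    (hx : x ≤ 10 ^ 8) : x / 4 ≤ 4 * (n / 6 : ℕ) * (p * (1 - p)) := by
  have hn : (10 ^ 8 : ℝ) ≤ n := le_cast_of_le_mul_one_sub hq
  have hk : (n : ℝ) / 2 ≤ 4 * (n / 6 : ℕ) := by linarith [cast_le_six_mul_add_five n]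
  have hpq := half_mul_le_mul_mul_one_sub hp (hx.trans hq)
  linarith [mul_le_mul_of_nonneg_right hk (mul_one_sub_nonneg p)]

theorem tendsto_modularityScore_partition_ge_of_large {p : ℕ → I}
    (h : ∀ᶠ n : ℕ in Filter.atTop, (10 ^ 8 : ℝ) ≤ n * p n ∧ (n : ℝ) * p n ≤ n - 10 ^ 8) :
    Filter.Tendsto (fun n : ℕ => G(Fin n, p n) {G | 1 / 5 * √((1 - (p n : ℝ)) / (n * p n))
      ≤ modularityScore G (partition G)}) Filter.atTop (nhds 1) := by
  rw [show (1 / 5 : ℝ) = 4 / 15 * (3 / 4) by norm_num]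
  refine tendsto_modularityScore_partition_ge (by norm_num) (h.mono fun n hn => ?_)
  have hq : 10 ^ 8 ≤ (n : ℝ) * (1 - p n) := by linarith
  refine ⟨by linarith, hq, fun i =>
    three_quarters_mul_le_integral_abs .of_finite ?_ (integral_cos_T_le i)⟩
  exact Real.le_sqrt_of_sq_le (by linarith [div_four_le_mul_mul hn.1 hq le_rfl])

theorem tendsto_modularityScore_partition_ge_of_one_le {p : ℕ → I}
    (h : ∀ᶠ n : ℕ in Filter.atTop, (1 : ℝ) ≤ n * p n ∧ (n : ℝ) * p n ≤ n - 10 ^ 8) :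
    Filter.Tendsto (fun n : ℕ => G(Fin n, p n)
      {G | 4 / 15 * (18 / 100) * √((1 - (p n : ℝ)) / (n * p n))
        ≤ modularityScore G (partition G)}) Filter.atTop (nhds 1) := by
  refine tendsto_modularityScore_partition_ge le_rfl (h.mono fun n hn => ?_)
  have hq : 10 ^ 8 ≤ (n : ℝ) * (1 - p n) := by linarith
  refine ⟨hn.1, hq, fun i => mul_le_integral_abs .of_finite ?_ (integral_cos_T_le i)⟩
  exact Real.le_sqrt_of_sq_le (by linarith [div_four_le_mul_mul hn.1 hq (by norm_num)])

end Whp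

end Swap

/-! ### Swap on the random access machine -/

namespace RAM

section Execution

@[simp, grind =]
theorem State.reg_setReg (s : State) (x v y : ℕ) :
    (s.setReg x v).reg y = if y = x then v else s.reg y := by
  simp [State.setReg, Function.update_apply]

@[simp, grind =]
theorem State.mem_setReg (s : State) (x v : ℕ) : (s.setReg x v).mem = s.mem := rfl

@[simp, grind =]
theorem State.reg_setMem (s : State) (i v x : ℕ) : (s.setMem i v).reg x = s.reg x := rfl

@[simp, grind =]
theorem State.mem_setMem (s : State) (i v j : ℕ) :
    (s.setMem i v).mem j = if j = i then v else s.mem j := by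
  simp [State.setMem, Function.update_apply]

@[simp, grind =]
theorem State.reg_init (x : ℕ) : State.init.reg x = 0 := rfl

theorem State.mem_init : State.init.mem = fun _ => 0 := rfl

/-- Execution of the commands of a list, one after the other. -/
def Cmd.block : List Cmd → Cmd
  | [] => .skip
  | c :: l => .seq c (block l)

/-- Total correctness with step count: started in `s`, the program `c` halts after some number `t`
of steps in a state `s'` with `Q t s'`. -/
def Runs (W : ℕ) (inp : ℕ → ℕ) (c : Cmd) (s : State) (Q : ℕ → State → Prop) : Prop :=
  ∃ t s', Exec W inp c s t s' ∧ Q t s'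

namespace Runs

variable {W : ℕ} {inp : ℕ → ℕ} {s : State} {x y z : ℕ} {c d : Cmd} {l : List Cmd}
  {Q R : ℕ → State → Prop}

theorem mono (h : Runs W inp c s Q) (hQ : ∀ t s, Q t s → R t s) : Runs W inp c s R := by
  obtain ⟨t, s', hexec, hs'⟩ := h
  exact ⟨t, s', hexec, hQ t s' hs'⟩

theorem const {k : ℕ} (h : k < W) (hQ : Q 1 (s.setReg x k)) : Runs W inp (.const x k) s Q :=
  ⟨1, _, .const s x k h, hQ⟩

theorem add (h : s.reg y + s.reg z < W) (hQ : Q 1 (s.setReg x (s.reg y + s.reg z))) :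
    Runs W inp (.add x y z) s Q :=
  ⟨1, _, .add s x y z h, hQ⟩

theorem sub (h : s.reg y - s.reg z < W) (hQ : Q 1 (s.setReg x (s.reg y - s.reg z))) :
    Runs W inp (.sub x y z) s Q :=
  ⟨1, _, .sub s x y z h, hQ⟩

theorem read (h : inp (s.reg y) < W) (hQ : Q 1 (s.setReg x (inp (s.reg y)))) :
    Runs W inp (.read x y) s Q :=
  ⟨1, _, .read s x y h, hQ⟩

theorem load (h : s.mem (s.reg y) < W) (hQ : Q 1 (s.setReg x (s.mem (s.reg y)))) :
    Runs W inp (.load x y) s Q :=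
  ⟨1, _, .load s x y h, hQ⟩

theorem store (h : s.reg y < W) (hQ : Q 1 (s.setMem (s.reg x) (s.reg y))) :
    Runs W inp (.store x y) s Q :=
  ⟨1, _, .store s x y h, hQ⟩

theorem nil (h : Q 1 s) : Runs W inp (.block []) s Q := ⟨1, s, .skip s, h⟩

theorem cons (h : Runs W inp c s fun t s' => Runs W inp (.block l) s' fun t' => Q (t + t')) :
    Runs W inp (.block (c :: l)) s Q := by
  obtain ⟨t, s', hc, t', s'', hl, hs''⟩ := h
  exact ⟨t + t', s'', .seq _ _ _ _ _ _ _ hc hl, hs''⟩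

theorem ite (hc : s.reg x < s.reg y → Runs W inp c s fun t => Q (1 + t))
    (hd : ¬ s.reg x < s.reg y → Runs W inp d s fun t => Q (1 + t)) :
    Runs W inp (.ifLt x y c d) s Q := by
  by_cases h : s.reg x < s.reg y
  · obtain ⟨t, s', hexec, hs'⟩ := hc h
    exact ⟨1 + t, s', .ifTrue _ _ _ _ _ _ _ h hexec, hs'⟩
  · obtain ⟨t, s', hexec, hs'⟩ := hd h
    exact ⟨1 + t, s', .ifFalse _ _ _ _ _ _ _ h hexec, hs'⟩

/-- A loop with invariant `I` whose running time is paid for by the potential `Φ`. -/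
theorem whileLt (I : State → Prop) (Φ : State → ℕ) (hs : I s)
    (hbody : ∀ s, I s → s.reg x < s.reg y → Runs W inp c s fun t s' => I s' ∧ 1 + t + Φ s' ≤ Φ s)
    (hexit : ∀ t s', t ≤ Φ s + 1 → I s' → ¬ s'.reg x < s'.reg y → Q t s') :
    Runs W inp (.whileLt x y c) s Q := by
  induction hm : Φ s using Nat.strong_induction_on generalizing s Q with
  | _ m ih =>
    by_cases h : s.reg x < s.reg y
    · obtain ⟨t, s', hexec, hs', hΦ⟩ := hbody s hs h
      obtain ⟨t', s'', hloop, hs''⟩ := ih (Φ s') (by omega) hs' (Q := fun t' => Q (1 + t + t'))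
        (fun t' s'' ht' => hexit _ s'' (by omega)) rfl
      exact ⟨1 + t + t', s'', .whileTrue _ _ _ _ _ _ _ _ h hexec hloop, hs''⟩
    · exact ⟨1, s, .whileFalse _ _ _ _ h, hexit 1 s (by omega) hs h⟩

end Runs

end Execution

section Input

variable {n : ℕ} (L : Fin n → List (Fin n))

/-- The part of the input that lists the neighbours of `v`. -/
def listBlock (v : Fin n) : List ℕ := (L v).length :: (L v).map Fin.val

/-- The position in the input where the list of the vertex `v` starts; for `v = n`, the length of
the input. -/
def listOffset (v : ℕ) : ℕ := (n :: ((List.finRange n).take v).flatMap (listBlock L)).length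

theorem listOffset_zero : listOffset L 0 = 1 := by simp [listOffset]

theorem listOffset_succ (v : Fin n) :
    listOffset L (v + 1) = listOffset L v + 1 + (L v).length := by
  rw [listOffset, List.take_add_one, List.getElem?_eq_getElem (by simp), List.flatMap_append,
    ← List.cons_append, List.length_append]
  simp [listOffset, listBlock]
  omega

theorem listOffset_mono : Monotone (listOffset L) := by
  intro v w hvw
  exact (((List.take_sublist_take_left hvw).flatMap _).cons_cons _).length_le

theorem input_listOffset_add (v : Fin n) {j : ℕ} (hj : j < (listBlock L v).length) :
    input L (listOffset L v + j) = (listBlock L v)[j] := by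
  have hrange : List.finRange n = (List.finRange n).take v ++
      (v :: (List.finRange n).drop (v + 1)) := by
    conv_lhs => rw [← List.take_append_drop v (List.finRange n)]
    rw [List.drop_eq_getElem_cons (by simp)]
    simp
  have hencode : encode L = (n :: ((List.finRange n).take v).flatMap (listBlock L)) ++
      (listBlock L v ++ ((List.finRange n).drop (v + 1)).flatMap (listBlock L)) := by
    rw [encode, List.cons_append, ← List.flatMap_cons, ← List.flatMap_append, ← hrange]
    rfl
  rw [input, hencode, listOffset, List.getD_append_right _ _ _ _ (Nat.le_add_right _ _),
    Nat.add_sub_cancel_left, List.getD_append _ _ _ _ hj, List.getD_eq_getElem _ _ hj]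

theorem input_zero : input L 0 = n := rfl

theorem input_listOffset (v : Fin n) : input L (listOffset L v) = (L v).length :=
  input_listOffset_add L v (j := 0) (by simp [listBlock])

theorem input_entry (v : Fin n) {j : ℕ} (hj : j < (L v).length) :
    input L (listOffset L v + 1 + j) = ((L v)[j]).val := by
  rw [Nat.add_assoc, Nat.add_comm 1 j, input_listOffset_add L v (by simpa [listBlock])]
  simp [listBlock]

variable {L} {G : SimpleGraph (Fin n)}

theorem IsAdjList.length_eq_degree [DecidableRel G.Adj] (hL : IsAdjList G L) (v : Fin n) :
    (L v).length = G.degree v := by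
  rw [← List.toFinset_card_of_nodup (hL v).1, ← SimpleGraph.card_neighborFinset_eq_degree]
  congr 1
  ext w
  simp [(hL v).2 w]

theorem IsAdjList.listOffset_card (hL : IsAdjList G L) :
    listOffset L n = 1 + n + 2 * G.edgeSet.ncard := by
  classical
  have hsum : ∀ l : List (Fin n),
      (l.flatMap (listBlock L)).length = l.length + (l.map fun v => G.degree v).sum := by
    intro l
    induction l with
    | nil => rfl
    | cons v l ih =>
      simp [ih, listBlock, ← hL.length_eq_degree]
      omega
  have hm : ((List.finRange n).map fun v => G.degree v).sum = 2 * G.edgeSet.ncard := by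
    rw [← SimpleGraph.coe_edgeFinset, Set.ncard_coe_finset, ← G.sum_degrees_eq_twice_card_edges,
      Fin.sum_univ_def]
  rw [listOffset, List.take_of_length_le (by simp), List.length_cons, hsum, hm,
    List.length_finRange]
  omega

theorem IsAdjList.countP_mem (hL : IsAdjList G L) (v : Fin n) (S : Finset (Fin n)) :
    (L v).countP (· ∈ S) = Swap.edgesTo G v S := by
  classical
  rw [List.countP_eq_length_filter, Swap.edgesTo,
    ← List.toFinset_card_of_nodup ((hL v).1.filter _)]
  congr 1
  ext w
  simp [(hL v).2 w, and_comm]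

end Input

section Program

/-- Add to `r_x` the content of the memory cell with address `r_α + r₁₂`. -/
def tally (x α : ℕ) : Cmd := .block [.add 13 12 α, .load 13 13, .add x x 13]

/-- One step of the scan of a list: read the next entry and tally it for two subsets. -/
def scanEntry (α β : ℕ) : Cmd := .block [.read 12 8, .add 8 8 1, tally 9 α, tally 10 β]

/-- The scan of the list that starts at the input position `r₈`. -/
def scanList (α β : ℕ) : Cmd :=
  .block [.read 11 8, .add 8 8 1, .add 11 8 11, .whileLt 8 11 (scanEntry α β)]

/-- The work memory holds, from the address `o` on, the indicator function of `S`. -/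
def State.Stores {n : ℕ} (s : State) (o : ℕ) (S : Finset (Fin n)) : Prop :=
  ∀ w : Fin n, s.mem (o + w) = if w ∈ S then 1 else 0

section Scan

theorem runs_tally {W n : ℕ} {inp : ℕ → ℕ} {s : State} {x α : ℕ} {S : Finset (Fin n)}
    (hx : x ≠ 13) {w : Fin n} (hw : s.reg 12 = w) (hS : s.Stores (s.reg α) S)
    (hWα : s.reg α + n < W) (hWx : s.reg x + 1 < W) :
    Runs W inp (tally x α) s fun t s' => t = 4 ∧ s'.mem = s.mem ∧
      (∀ y, y ≠ x → y ≠ 13 → s'.reg y = s.reg y) ∧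
      s'.reg x = s.reg x + if w ∈ S then 1 else 0 := by
  have hSw := hS w
  refine .cons <| .add ?_ <| .cons <| .load ?_ <| .cons <| .add ?_ <| .nil ⟨rfl, rfl, ?_, ?_⟩ <;>
    grind

variable {W n : ℕ} {L : Fin n → List (Fin n)} {α β : ℕ} {S S' : Finset (Fin n)} {v : Fin n}
  {s s' : State}

/-- In the state `s`, `scanList α β` is about to read the list of `v`, with the indicator functions
of `S` and `S'` stored from `r_α` and `r_β` on. -/
structure ScanStart (W : ℕ) (L : Fin n → List (Fin n)) (α β : ℕ) (S S' : Finset (Fin n)) (v : Fin n)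
    (s : State) : Prop where
  α_lt : α < 8
  β_lt : β < 8
  one : s.reg 1 = 1
  pos : s.reg 8 = listOffset L v
  stores : s.Stores (s.reg α) S
  stores' : s.Stores (s.reg β) S'
  α_bound : s.reg α + n < W
  β_bound : s.reg β + n < W
  pos_bound : listOffset L n < W
  count_bound : s.reg 9 + (L v).length < W
  count_bound' : s.reg 10 + (L v).length < W

/-- The state `s'` is reached from `s` by reading the first `j` entries of the list of `v`. -/
structure Scanned (L : Fin n → List (Fin n)) (S S' : Finset (Fin n)) (v : Fin n) (s : State) (j : ℕ)
    (s' : State) : Prop where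
  mem : s'.mem = s.mem
  reg : ∀ x < 8, s'.reg x = s.reg x
  pos : s'.reg 8 = listOffset L v + 1 + j
  count : s'.reg 9 = s.reg 9 + ((L v).take j).countP (· ∈ S)
  count' : s'.reg 10 = s.reg 10 + ((L v).take j).countP (· ∈ S')

theorem countP_take_succ {j : ℕ} (hj : j < (L v).length) :
    ((L v).take (j + 1)).countP (· ∈ S) =
      ((L v).take j).countP (· ∈ S) + if (L v)[j] ∈ S then 1 else 0 := by
  rw [List.take_add_one, List.getElem?_eq_getElem hj, List.countP_append]
  simp [List.countP_cons]

theorem countP_take_add_le {j : ℕ} (hj : j < (L v).length) :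
    ((L v).take j).countP (· ∈ S) + 1 ≤ (L v).length :=
  (Nat.add_le_add_right List.countP_le_length 1).trans (by simp; omega)

theorem runs_scanEntry (h : ScanStart W L α β S S' v s) {j : ℕ} (hj : j < (L v).length)
    (hs' : Scanned L S S' v s j s') :
    Runs W (input L) (scanEntry α β) s' fun t s'' =>
      t = 11 ∧ Scanned L S S' v s (j + 1) s'' ∧ s''.reg 11 = s'.reg 11 := by
  have hentry : input L (s'.reg 8) = (L v)[j] := by rw [hs'.pos, input_entry L v hj]
  have hsucc := listOffset_succ L v
  have hle : listOffset L (v + 1) ≤ listOffset L n := listOffset_mono L v.isLt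
  have hcount := countP_take_succ (S := S) hj
  have hcount' := countP_take_succ (S := S') hj
  have hcle := countP_take_add_le (S := S) hj
  have hcle' := countP_take_add_le (S := S') hj
  obtain ⟨hα, hβ, hone, -, hS, hS', hWα, hWβ, hWL, hW9, hW10⟩ := h
  obtain ⟨hmem, hreg, hpos, hc, hc'⟩ := hs'
  refine .cons <| .read ?_ <| .cons <| .add ?_ <| .cons <|
    (runs_tally (w := (L v)[j]) (S := S) ?_ ?_ ?_ ?_ ?_).mono fun _ _ _ => .cons <|
    (runs_tally (w := (L v)[j]) (S := S') ?_ ?_ ?_ ?_ ?_).mono fun _ _ _ =>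
      .nil ⟨?_, ⟨?_, ?_, ?_, ?_, ?_⟩, ?_⟩
  all_goals grind [State.Stores]

theorem runs_scanList (h : ScanStart W L α β S S' v s) :
    Runs W (input L) (scanList α β) s fun t s' =>
      t ≤ 12 * (L v).length + 5 ∧ Scanned L S S' v s (L v).length s' := by
  have hsucc := listOffset_succ L v
  have hle : listOffset L (v + 1) ≤ listOffset L n := listOffset_mono L v.isLt
  refine .cons <| .read ?_ <| .cons <| .add ?_ <| .cons <| .add ?_ <| .cons <| .whileLt
    (fun s' => s'.reg 11 = listOffset L (v + 1) ∧ ∃ j ≤ (L v).length, Scanned L S S' v s j s')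
    (fun s' => 12 * (s'.reg 11 - s'.reg 8)) ⟨?_, 0, Nat.zero_le _, ⟨?_, ?_, ?_, ?_, ?_⟩⟩ ?_
    fun t s' ht ⟨_, j, _, hs'⟩ hlt => .nil ?_
  rotate_right 2
  · rintro s' ⟨hend, j, _, hs'⟩ hlt
    have hpos := hs'.pos
    refine (runs_scanEntry h (by omega) hs').mono fun _ s'' ⟨_, hs'', hend'⟩ =>
      ⟨⟨hend'.trans hend, j + 1, by omega, hs''⟩, ?_⟩
    grind [Scanned]
  · have hpos := hs'.pos
    obtain rfl : j = (L v).length := by omega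
    exact ⟨by grind [input_listOffset, ScanStart], hs'⟩
  all_goals grind [input_listOffset, ScanStart]

end Scan

section Fill

/-- Write `1` into the cells with addresses `r₇`, `r₇ + 2`, `r₇ + 4`, … below `r₁₁`. -/
def fill : Cmd := .whileLt 7 11 (.block [.store 7 1, .add 7 7 6])

theorem runs_fill {W : ℕ} {inp : ℕ → ℕ} {s : State} (hone : s.reg 1 = 1) (htwo : s.reg 6 = 2)
    (hle : s.reg 7 ≤ s.reg 11 + 1) (hW : s.reg 11 + 1 < W) :
    Runs W inp fill s fun t s' => t ≤ 4 * (s.reg 11 - s.reg 7) + 1 ∧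
      (∀ x ≠ 7, s'.reg x = s.reg x) ∧ ∀ c, s'.mem c =
        if s.reg 7 ≤ c ∧ c < s.reg 11 ∧ c % 2 = s.reg 7 % 2 then 1 else s.mem c := by
  refine .whileLt
    (fun s' => s.reg 7 ≤ s'.reg 7 ∧ s'.reg 7 ≤ s.reg 11 + 1 ∧ s'.reg 7 % 2 = s.reg 7 % 2 ∧
      (∀ x ≠ 7, s'.reg x = s.reg x) ∧ ∀ c, s'.mem c =
        if s.reg 7 ≤ c ∧ c < s'.reg 7 ∧ c % 2 = s.reg 7 % 2 then 1 else s.mem c)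
    (fun s' => 4 * (s.reg 11 - s'.reg 7)) (by grind) ?_ ?_
  · rintro s' ⟨hge, _, hparity, hreg, hmem⟩ hlt
    have hone' : s'.reg 1 = 1 := by rw [hreg 1 (by decide), hone]
    have htwo' : s'.reg 6 = 2 := by rw [hreg 6 (by decide), htwo]
    have hend : s'.reg 11 = s.reg 11 := hreg 11 (by decide)
    refine .cons <| .store (by omega) <| .cons <| .add ?_ <| .nil ⟨⟨?_, ?_, ?_, ?_, ?_⟩, ?_⟩
    case refine_6 =>
      intro c
      simp [hmem, hone', htwo']
      split_ifs <;> omega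
    all_goals grind
  · rintro t s' ht ⟨_, hle', hparity, hreg, hmem⟩ hlt
    have hend : s'.reg 11 = s.reg 11 := hreg 11 (by decide)
    refine ⟨ht, hreg, fun c => ?_⟩
    rw [hmem]
    congr 1
    grind

end Fill

section Constants

/-- The registers `r₀, …, r₆` hold the constants `0, 1, n, 2n, 4k, 6k, 2`, where `k = ⌊n/6⌋`. -/
structure Constants (n : ℕ) (s : State) : Prop where
  zero : s.reg 0 = 0
  one : s.reg 1 = 1
  size : s.reg 2 = n
  two_size : s.reg 3 = 2 * n
  four : s.reg 4 = 4 * (n / 6)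
  six : s.reg 5 = 6 * (n / 6)
  two : s.reg 6 = 2

theorem Constants.congr {n : ℕ} {s s' : State} (h : Constants n s)
    (hreg : ∀ x < 7, s'.reg x = s.reg x) : Constants n s' := by
  obtain ⟨_, _, _, _, _, _, _⟩ := h
  constructor <;> grind

/-- Load the constants; `4k` and `6k` are found by counting up in steps of `4` and `6`. -/
def loadConstants : Cmd :=
  .block [.const 1 1, .read 2 0, .add 3 2 2, .const 6 2, .const 11 5, .const 12 6, .const 13 4,
    .whileLt 11 2 (.block [.add 11 11 12, .add 4 4 13]), .const 13 5, .sub 5 11 13]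

theorem runs_loadConstants {W n : ℕ} {inp : ℕ → ℕ} (hn : inp 0 = n) (hW : 2 * n + 6 < W) :
    Runs W inp loadConstants .init fun t s =>
      t ≤ 4 * n + 11 ∧ Constants n s ∧ s.mem = fun _ => 0 := by
  refine .cons <| .const ?_ <| .cons <| .read ?_ <| .cons <| .add ?_ <| .cons <| .const ?_ <|
    .cons <| .const ?_ <| .cons <| .const ?_ <| .cons <| .const ?_ <| .cons <| .whileLt
      (fun s => (s.reg 0 = 0 ∧ s.reg 1 = 1 ∧ s.reg 2 = n ∧ s.reg 3 = 2 * n ∧ s.reg 6 = 2 ∧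
        s.reg 12 = 6 ∧ s.reg 13 = 4 ∧ s.mem = fun _ => 0) ∧
        ∃ j, s.reg 4 = 4 * j ∧ s.reg 11 = 6 * j + 5 ∧ 6 * j ≤ n)
      (fun s => 4 * (n - s.reg 11)) ⟨?_, 0, ?_⟩ ?_ ?_
  case refine_10 =>
    rintro s ⟨⟨_, _, _, _, _, _, _, _⟩, j, _, _, _⟩ hlt
    refine .cons <| .add ?_ <| .cons <| .add ?_ <| .nil ⟨⟨?_, j + 1, ?_⟩, ?_⟩ <;> grind
  case refine_11 =>
    rintro t s ht ⟨⟨_, _, _, _, _, _, _, _⟩, j, _, _, _⟩ hlt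
    refine .cons <| .const ?_ <| .cons <| .sub ?_ <| .nil ⟨?_, ⟨?_, ?_, ?_, ?_, ?_, ?_, ?_⟩, ?_⟩ <;>
      grind
  all_goals grind [State.mem_init]

end Constants

section Loop

variable {W n : ℕ} {inp : ℕ → ℕ} {L : Fin n → List (Fin n)} {G : SimpleGraph (Fin n)} {s : State}

theorem mem_A₁_iff {w : Fin n} :
    w ∈ Swap.A₁ n ↔ w.val % 2 = 0 ∧ 4 * (n / 6) ≤ w.val ∧ w.val < 6 * (n / 6) := by
  simp only [Swap.A₁, Swap.label, Finset.mem_filter, Finset.mem_univ, true_and, Nat.odd_iff]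
  omega

theorem mem_B₁_iff {w : Fin n} :
    w ∈ Swap.B₁ n ↔ w.val % 2 = 1 ∧ 4 * (n / 6) ≤ w.val ∧ w.val < 6 * (n / 6) := by
  simp only [Swap.B₁, Swap.label, Finset.mem_filter, Finset.mem_univ, true_and, Nat.even_iff]
  omega

open scoped Classical in
/-- The set that is marked in the work memory after `i` pairs have been processed: the part `A'` on
these pairs, and the vertices of odd label elsewhere. -/
noncomputable def marked (G : SimpleGraph (Fin n)) (i : ℕ) : Finset (Fin n) :=
  Finset.univ.filter fun v => if v.val < 2 * i then v ∈ Swap.partA G else v.val % 2 = 0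

theorem mem_marked {i : ℕ} {v : Fin n} :
    v ∈ marked G i ↔ if v.val < 2 * i then v ∈ Swap.partA G else v.val % 2 = 0 := by
  simp [marked]

theorem mem_marked_succ {i : Fin (2 * (n / 6))} {v : Fin n} :
    v ∈ marked G (i + 1) ↔
      if v = Swap.a i then ¬ 0 < Swap.T G i else
      if v = Swap.b i then 0 < Swap.T G i else v ∈ marked G i := by
  have ha := Swap.a_mem_partA G i
  have hb := Swap.b_mem_partA G i
  grind [mem_marked, Swap.a, Swap.b]

theorem marked_eq_partA : marked G (2 * (n / 6)) = Swap.partA G := by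
  ext v
  have := Swap.mem_partA_of_le G (v := v)
  grind [mem_marked]

/-- The state of the machine after `i` pairs have been processed. -/
structure SwapInvariant (L : Fin n → List (Fin n)) (G : SimpleGraph (Fin n)) (i : ℕ)
    (s : State) : Prop extends Constants n s where
  vertex : s.reg 7 = 2 * i
  pos : s.reg 8 = listOffset L (2 * i)
  stores_A₁ : s.Stores n (Swap.A₁ n)
  stores_B₁ : s.Stores (2 * n) (Swap.B₁ n)
  stores_marked : s.Stores 0 (marked G i)

/-- Write `1` into every second cell from the address `r_o + r_x + r_y` on and below
`r_o + r_z`. -/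
def fillTable (o x y z : ℕ) : Cmd := .block [.add 7 o x, .add 7 7 y, .add 11 o z, fill]

theorem runs_fillTable {o x y z : ℕ} (h : Constants n s) (ho : o < 7) (hy : y < 7) (hz : z < 7)
    (hle : s.reg x + s.reg y ≤ s.reg z + 1) (hW : s.reg o + s.reg z + 1 < W) :
    Runs W inp (fillTable o x y z) s fun t s' =>
      t ≤ 4 * (s.reg z - s.reg x) + 5 ∧ Constants n s' ∧ ∀ c, s'.mem c =
        if s.reg o + s.reg x + s.reg y ≤ c ∧ c < s.reg o + s.reg z ∧
          c % 2 = (s.reg o + s.reg x + s.reg y) % 2 then 1 else s.mem c := by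
  have hone := h.one
  have htwo := h.two
  refine .cons <| .add ?_ <| .cons <| .add ?_ <| .cons <| .add ?_ <| .cons <|
    (runs_fill ?_ ?_ ?_ ?_).mono fun _ _ ⟨_, _, _⟩ =>
      .nil ⟨?_, h.congr fun _ _ => ?_, fun _ => ?_⟩
  all_goals grind

/-- Store the indicator functions of the vertices of odd label, of `A₁` and of `B₁`, from the
addresses `0`, `n` and `2n` on. -/
def initTables : Cmd :=
  .block [fillTable 0 0 0 2, fillTable 2 4 0 5, fillTable 3 4 1 5, .const 7 0, .const 8 1]

theorem runs_initTables (h : Constants n s) (hmem : s.mem = fun _ => 0) (hW : 3 * n + 3 < W) :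
    Runs W inp initTables s fun t s' => t ≤ 8 * n + 18 ∧ SwapInvariant L G 0 s' := by
  obtain ⟨_, _, _, _, _, _, _⟩ := id h
  refine .cons <| (runs_fillTable h (by decide) (by decide) (by decide) (by omega)
    (by omega)).mono fun _ s₁ ⟨_, h₁, _⟩ => ?_
  obtain ⟨_, _, _, _, _, _, _⟩ := id h₁
  refine .cons <| (runs_fillTable h₁ (by decide) (by decide) (by decide) (by omega)
    (by omega)).mono fun _ s₂ ⟨_, h₂, _⟩ => ?_
  obtain ⟨_, _, _, _, _, _, _⟩ := id h₂
  refine .cons <| (runs_fillTable h₂ (by decide) (by decide) (by decide) (by omega)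
    (by omega)).mono fun _ s₃ ⟨_, h₃, _⟩ => ?_
  have hcells (c : ℕ) : s₃.mem c =
      if c < n ∧ c % 2 = 0 ∨ n + 4 * (n / 6) ≤ c ∧ c < n + 6 * (n / 6) ∧ c % 2 = n % 2 ∨
        2 * n + 4 * (n / 6) < c ∧ c < 2 * n + 6 * (n / 6) ∧ c % 2 = 1 then 1 else 0 := by
    simp only [*]
    split_ifs <;> omega
  refine .cons <| .const ?_ <| .cons <| .const ?_ <| .nil ⟨?_, h₃.congr ?_, ?_, ?_,
    fun w => ?_, fun w => ?_, fun w => ?_⟩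
  case refine_7 =>
    simp only [State.mem_setReg, hcells, mem_A₁_iff]
    grind
  case refine_8 =>
    simp only [State.mem_setReg, hcells, mem_B₁_iff]
    grind
  case refine_9 =>
    simp only [State.mem_setReg, hcells, mem_marked]
    grind
  all_goals grind [listOffset_zero]

/-- Count the edges from the current pair `(a, b)`: `r₉ := e(a, A₁) + e(b, B₁)` and
`r₁₀ := e(a, B₁) + e(b, A₁)`. -/
def scanPair : Cmd := .block [.const 9 0, .const 10 0, scanList 2 3, scanList 3 2]

theorem runs_scanPair (hL : IsAdjList G L) {i : Fin (2 * (n / 6))} (h : SwapInvariant L G i s)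
    (hW : 3 * n + listOffset L n < W) :
    Runs W (input L) scanPair s fun t s' =>
      t + 11 + 12 * listOffset L (2 * i) ≤ 12 * listOffset L (2 * (i + 1)) ∧ s'.mem = s.mem ∧
      (∀ x < 8, s'.reg x = s.reg x) ∧ s'.reg 8 = listOffset L (2 * (i + 1)) ∧
      (s'.reg 9 < s'.reg 10 ↔ 0 < Swap.T G i) := by
  have ha : listOffset L (2 * i + 1) = listOffset L (2 * i) + 1 + (L (Swap.a i)).length :=
    listOffset_succ L (Swap.a i)
  have hb : listOffset L (2 * i + 2) = listOffset L (2 * i + 1) + 1 + (L (Swap.b i)).length :=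
    listOffset_succ L (Swap.b i)
  have hle : listOffset L (2 * i + 2) ≤ listOffset L n := listOffset_mono L (Swap.b i).isLt
  have hcount := hL.countP_mem
  obtain ⟨⟨_, _, _, _, _, _, _⟩, _, _, _, _, _⟩ := h
  refine .cons <| .const (by omega) <| .cons <| .const (by omega) <| .cons <|
    (runs_scanList (v := Swap.a i) (S := Swap.A₁ n) (S' := Swap.B₁ n)
      ⟨by decide, by decide, ?_, ?_, ?_, ?_, ?_, ?_, ?_, ?_, ?_⟩).mono
    fun t₁ s₁ ⟨_, hmem₁, hreg₁, hpos₁, hc₁, hc₁'⟩ => .cons <|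
    (runs_scanList (v := Swap.b i) (S := Swap.B₁ n) (S' := Swap.A₁ n)
      ⟨by decide, by decide, ?_, ?_, ?_, ?_, ?_, ?_, ?_, ?_, ?_⟩).mono
    fun t₂ s₂ ⟨_, hmem₂, hreg₂, hpos₂, hc₂, hc₂'⟩ => .nil ⟨?_, ?_, ?_, ?_, ?_⟩
  all_goals grind [State.Stores, Swap.T, Swap.a, Swap.b]

/-- If the current pair is to be swapped, then replace its marks `1, 0` by `0, 1`. -/
def updateMarks : Cmd := .ifLt 9 10 (.block [.store 7 0, .add 13 7 1, .store 13 1]) (.block [])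

theorem runs_updateMarks (hzero : s.reg 0 = 0) (hone : s.reg 1 = 1) (hW : s.reg 7 + 1 < W) :
    Runs W inp updateMarks s fun t s' => t ≤ 5 ∧ (∀ x ≠ 13, s'.reg x = s.reg x) ∧
      ∀ c, s'.mem c = if s.reg 9 < s.reg 10 ∧ c = s.reg 7 then 0 else
        if s.reg 9 < s.reg 10 ∧ c = s.reg 7 + 1 then 1 else s.mem c := by
  refine .ite (fun _ => .cons <| .store ?_ <| .cons <| .add ?_ <| .cons <| .store ?_ <|
    .nil ⟨?_, ?_, ?_⟩) fun _ => .nil ⟨?_, ?_, ?_⟩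
  case refine_6 =>
    simp only [State.mem_setMem, State.mem_setReg]
    grind
  all_goals grind

/-- Process the current pair and move on to the next one. -/
def swapPair : Cmd := .block [scanPair, updateMarks, .add 7 7 6]

theorem runs_swapPair (hL : IsAdjList G L) {i : Fin (2 * (n / 6))} (h : SwapInvariant L G i s)
    (hW : 3 * n + listOffset L n < W) :
    Runs W (input L) swapPair s fun t s' => SwapInvariant L G (i + 1) s' ∧
      t + 1 + 12 * listOffset L (2 * i) ≤ 12 * listOffset L (2 * (i + 1)) := by
  refine .cons <| (runs_scanPair hL h hW).mono fun t₁ s₁ ⟨_, hmem₁, hreg₁, _, hT⟩ => ?_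
  obtain ⟨h, _, -, hA, hB, hmarked⟩ := h
  have h₁ : Constants n s₁ := h.congr fun x hx => hreg₁ x (by omega)
  have hvertex : s₁.reg 7 = 2 * i := by grind
  have hi : 2 * i.val + 1 < n := by omega
  obtain ⟨_, _, _, _, _, _, _⟩ := id h₁
  refine .cons <| (runs_updateMarks h₁.zero h₁.one (by omega)).mono fun t₂ s₂ ⟨_, _, hmem₂⟩ =>
    .cons <| .add ?_ <| .nil ⟨⟨h₁.congr ?_, ?_, ?_, fun w => ?_, fun w => ?_, fun w => ?_⟩, ?_⟩
  case refine_5 =>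
    simp only [State.mem_setReg, hmem₂, hT, hvertex]
    grind [State.Stores]
  case refine_6 =>
    simp only [State.mem_setReg, hmem₂, hT, hvertex]
    grind [State.Stores]
  case refine_7 =>
    simp only [State.mem_setReg, hmem₂, hT, hvertex, hmem₁, hmarked w, mem_marked_succ, Swap.a,
      Swap.b, Fin.ext_iff]
    grind [mem_marked]
  all_goals grind

/-- The algorithm Swap. -/
def swapProgram : Cmd := .block [loadConstants, initTables, .whileLt 7 4 swapPair]

theorem runs_swapProgram (hL : IsAdjList G L) (hW : 3 * n + listOffset L n + 6 < W) :
    Runs W (input L) swapProgram .init fun t s =>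
      t ≤ 12 * n + 12 * listOffset L n + 31 ∧ s.Stores 0 (Swap.partA G) := by
  refine .cons <| (runs_loadConstants (input_zero L) (by omega)).mono fun _ s₁ ⟨_, h₁, hmem₁⟩ =>
    .cons <| (runs_initTables (L := L) (G := G) h₁ hmem₁ (by omega)).mono fun t₂ s₂ ⟨ht₂, h₂⟩ =>
    .cons <| .whileLt (fun s => ∃ i ≤ 2 * (n / 6), SwapInvariant L G i s)
      (fun s => 12 * (listOffset L n - s.reg 8)) ⟨0, Nat.zero_le _, h₂⟩ ?_ ?_
  · rintro s ⟨i, _, h⟩ hlt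
    have hi : i < 2 * (n / 6) := by grind [SwapInvariant, Constants]
    have hle : listOffset L (2 * (i + 1)) ≤ listOffset L n := listOffset_mono L (by omega)
    refine (runs_swapPair hL (i := ⟨i, hi⟩) h (by omega)).mono fun t s' ⟨h', ht⟩ =>
      ⟨⟨i + 1, hi, h'⟩, ?_⟩
    have hpos := h.pos
    have hpos' : s'.reg 8 = listOffset L (2 * (i + 1)) := h'.pos
    dsimp only at ht ⊢
    omega
  · rintro t s ht ⟨i, hi, h⟩ hlt
    obtain rfl : i = 2 * (n / 6) := by grind [SwapInvariant, Constants]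
    refine .nil ⟨?_, marked_eq_partA (G := G) ▸ h.stores_marked⟩
    omega

theorem computesInLinearTime_swapProgram : ComputesInLinearTime swapProgram Swap.partA := by
  refine ⟨100, fun n hn G L hL => ?_⟩
  have hlen := hL.listOffset_card
  obtain ⟨t, s, hexec, ht, hs⟩ :=
    runs_swapProgram hL (W := 100 * (n + G.edgeSet.ncard)) (by omega)
  exact ⟨t, s, hexec, by omega, fun v => by simpa using hs v⟩

end Loop

end Program

end RAM

theorem theorem4p1 :
    -- Swap constructs a balanced bipartition
    (∀ n : ℕ, 2 ≤ n → ∀ G : SimpleGraph (Fin n),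
      (Swap.partition G).parts.card = 2 ∧ (Swap.partition G).IsEquipartition) ∧
    -- in linear time
    (∃ P : RAM.Cmd, RAM.ComputesInLinearTime P Swap.partA) ∧
    -- and the bipartition has large modularity score on the binomial random graph whp
    ∃ c₀ a : ℝ, 0 < c₀ ∧ 0 < a ∧
      (∀ p : ℕ → unitInterval,
        (∀ᶠ n : ℕ in Filter.atTop,
          c₀ ≤ (n : ℝ) * (p n : ℝ) ∧ (n : ℝ) * (p n : ℝ) ≤ (n : ℝ) - c₀) →
        Filter.Tendsto
          (fun n : ℕ => SimpleGraph.binomialRandom (Fin n) (p n)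
            {G | 1 / 5 * Real.sqrt ((1 - (p n : ℝ)) / ((n : ℝ) * (p n : ℝ)))
              ≤ modularityScore G (Swap.partition G)})
          Filter.atTop (nhds 1)) ∧
      (∀ p : ℕ → unitInterval,
        (∀ᶠ n : ℕ in Filter.atTop,
          1 ≤ (n : ℝ) * (p n : ℝ) ∧ (n : ℝ) * (p n : ℝ) ≤ (n : ℝ) - c₀) →
        Filter.Tendsto
          (fun n : ℕ => SimpleGraph.binomialRandom (Fin n) (p n)
            {G | a * Real.sqrt ((1 - (p n : ℝ)) / ((n : ℝ) * (p n : ℝ)))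
              ≤ modularityScore G (Swap.partition G)})
          Filter.atTop (nhds 1)) :=
  ⟨fun _ hn G => ⟨Swap.card_parts_partition hn G, Swap.isEquipartition_partition hn G⟩,
    ⟨RAM.swapProgram, RAM.computesInLinearTime_swapProgram⟩,
    10 ^ 8, 4 / 15 * (18 / 100), by norm_num, by norm_num,
    fun _ hp => Swap.tendsto_modularityScore_partition_ge_of_large hp,
    fun _ hp => Swap.tendsto_modularityScore_partition_ge_of_one_le hp⟩
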